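/- **Setting.** $K$ single-antenna UEs are served by $L$ APs with $N$ antennas each; $\tau$ is the pilot length and $\tau_c\ge\tau$ the length of a coherence block. UE $i$ has power $p_i\ge 0$; $\sigma^2>0$ is the noise power; $\rho_{da},\rho_{ad}\in[0,1)$ are the DAC and ADC distortion factors; $\ddot p_i=(1-\rho_{da})p_i$. For a square matrix $A$, $\mathrm{diag}(A)$ is its diagonal part. $\mathcal{CN}(m,R)$ is the circularly symmetric complex Gaussian law. *Channels.* $h_{il}=\bar h_{il}+h_{w,il}\in\mathbb C^N$ with $h_{w,il}\sim\mathcal{CN}(0,R_{il})$, $R_{il}$ positive semidefinite, and $\bar h_{il}=\sqrt{\beta_{il}\kappa_{il}/(\kappa_{il}+1)}\,[1,e^{-j\pi\sin\theta_{il}},\dots,e^{-j(N-1)\pi\sin\theta_{il}}]^T$, where $\beta_{il},\kappa_{il}\ge0$ and $\theta_{il}\in\mathbb R$. *Channel estimation.* UE $i$ uses the column $\phi_{t_i}$ of the $\tau\times\tau$ DFT matrix (with entries of modulus 1), and $\mathcal P_k=\{i: t_i=t_k\}$. AP $l$ receives $Z_l=(1-\rho_{ad})\sum_i\sqrt{\ddot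 p_i}\,h_{il}\phi_{t_i}^T+N_l$, where the columns of $N_l$ are independent $\mathcal{CN}(0,C_{n,l})$ and, with $S_l=\sum_i\ddot p_i(\bar h_{il}\bar h_{il}^H+R_{il})$, $$C_{n,l}=\tfrac{(1-\rho_{ad})^2\rho_{da}}{1-\rho_{da}}S_l+\tfrac{\rho_{ad}(1-\rho_{ad})}{1-\rho_{da}}\mathrm{diag}(S_l)+(1-\rho_{ad})\sigma^2I_N.$$ Put $z^w_{kl}=Z_l\phi_{t_k}^*/\sqrt\tau-(1-\rho_{ad})\sum_{i\in\mathcal P_k}\sqrt{\ddot p_i\tau}\,\bar h_{il}$, $\Psi_{kl}=(1-\rho_{ad})^2\sum_{i\in\mathcal P_k}\ddot p_i\tau R_{il}+C_{n,l}$, and let $\hat h_{kl}=\bar h_{kl}+(1-\rho_{ad})\sqrt{\ddot p_k\tau}\,R_{kl}\Psi_{kl}^{-1}z^w_{kl}$ be the MMSE estimate. *Data phase.* $s_i\sim\mathcal{CN}(0,p_i)$, $n_{da,i}\sim\mathcal{CN}(0,\rho_{da}p_i)$, $n_{an,l}\sim\mathcal{CN}(0,\sigma^2I_N)$, and $n_{ad,l}\sim\mathcal{CN}(0,\rho_{ad}(1-\rho_{ad})\mathrm{diag}(\mathbb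 E[x_lx_l^H]))$ with $x_l=\sum_ih_{il}(\sqrt{1-\rho_{da}}\,s_i+n_{da,i})+n_{an,l}$. The effective noise at AP $l$ is $n_l=(1-\rho_{ad})\sum_ih_{il}n_{da,i}+(1-\rho_{ad})n_{an,l}+n_{ad,l}$. All of $h_{w,il}$, the columns of the $N_l$, $s_i$, $n_{da,i}$, $n_{an,l}$, $n_{ad,l}$ (over all $i$, $l$) are mutually independent. *Spectral efficiency.* $\mathcal M_k\subseteq\{1,\dots,L\}$ is the set of APs that serve UE $k$. Let $D_k$ be the block diagonal matrix whose $l$-th block is $I_N$ if $l\in\mathcal M_k$ and $0$ otherwise, and $\mathcal Q_k=\{i:D_kD_i\ne0\}$. With MRC, i.e. with combining vectors $\hat h_{kl}$, put $g_{ki}=[\hat h_{kl}^Hh_{il}\mid l\in\mathcal M_k]^T$ and $f_k=[\hat h_{kl}^Hn_l\mid l\in\mathcal M_k]^T$. For a CPU weighting vector $a_k$ the UL SE of UE $k$ is $$R_k^d=\Big(1-\frac{\tau}{\tau_c}\Big)\log_2\Big(1+\frac{(1-\rho_{ad})^2\ddot p_k|a_k^H\mathbb E[g_{kk}]|^2}{(1-\rho_{ad})^2\sum_{i=1}^K\ddot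 p_i\mathbb E[|a_k^Hg_{ki}|^2]-(1-\rho_{ad})^2\ddot p_k|a_k^H\mathbb E[g_{kk}]|^2+a_k^H\mathbb E[f_kf_k^H]a_k}\Big).$$ *Closed-form quantities.* For $l\in\mathcal M_k$ let $\lambda_{kl}^i=\bar h_{kl}^H\bar h_{il}$, $b_{kl}^i=(1-\rho_{ad})^2\tau\sqrt{\ddot p_k\ddot p_i}\,\mathrm{tr}(R_{il}\Psi_{kl}^{-1}R_{kl})$, $$c_{kl}^i=(1-\rho_{ad})^2\tau\ddot p_k\,\mathrm{tr}(R_{il}R_{kl}\Psi_{kl}^{-1}R_{kl})+\bar h_{kl}^HR_{il}\bar h_{kl}+(1-\rho_{ad})^2\tau\ddot p_k\,\bar h_{il}^HR_{kl}\Psi_{kl}^{-1}R_{kl}\bar h_{il},$$ and, with $\Delta_l=\mathrm{diag}(\sum_i\ddot p_iR_{il})$, $$d_{kl}=\tfrac{\rho_{ad}(1-\rho_{ad})}{1-\rho_{da}}\bar h_{kl}^H\Delta_l\bar h_{kl}+\tfrac{\rho_{ad}(1-\rho_{ad})^3}{1-\rho_{da}}\tau\ddot p_k\mathrm{tr}(\Delta_lR_{kl}\Psi_{kl}^{-1}R_{kl})+(1-\rho_{ad})\Big[\sigma^2+\tfrac{\rho_{ad}}{1-\rho_{da}}\sum_i\tfrac{\ddot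 p_i\beta_{il}\kappa_{il}}{\kappa_{il}+1}\Big]\big[\bar h_{kl}^H\bar h_{kl}+(1-\rho_{ad})^2\tau\ddot p_k\mathrm{tr}(R_{kl}\Psi_{kl}^{-1}R_{kl})\big].$$ Let $\lambda_k^i,b_k^i$ be the vectors and $\Lambda(c_k^i),\Lambda(d_k)$ the diagonal matrices with these entries, $l\in\mathcal M_k$. For a set $Q$ of UEs let $$C_k(Q)=\tfrac{(1-\rho_{ad})^2}{1-\rho_{da}}\Big\{\sum_{i\in Q}\ddot p_i\big[\lambda_k^i(\lambda_k^i)^H+\Lambda(c_k^i)\big]+\sum_{i\in\mathcal P_k\cap Q}\ddot p_i\big[b_k^i(b_k^i)^H+b_k^i(\lambda_k^i)^H+\lambda_k^i(b_k^i)^H\big]\Big\}-(1-\rho_{ad})^2\ddot p_k(\lambda_k^k+b_k^k)(\lambda_k^k+b_k^k)^H+\Lambda(d_k),$$ $C_k=C_k(\{1,\dots,K\})$ and $C_k^P=C_k(\mathcal Q_k)$. The P-LSFD vector is $$a_k^{P-MR}=\Big[\Lambda(d_k)+\tfrac{(1-\rho_{ad})^2}{1-\rho_{da}}\sum_{i\in\mathcal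 Q_k}\ddot p_i\mathbb E[g_{ki}g_{ki}^H]-(1-\rho_{ad})^2\ddot p_k\mathbb E[g_{kk}]\mathbb E[g_{kk}^H]\Big]^{-1}\mathbb E[g_{kk}].$$ **Corollary.** The P-LSFD vector equals $a_k^{P-MR}=(C_k^P)^{-1}(\lambda_k^k+b_k^k)$, and with MRC at each AP and $a_k=a_k^{P-MR}$ at the CPU, the UL SE of UE $k$ is $$R_k^d=\Big(1-\frac{\tau}{\tau_c}\Big)\log_2\Big(1+\frac{(1-\rho_{ad})^2\ddot p_k\big|(a_k^{P-MR})^H(\lambda_k^k+b_k^k)\big|^2}{(a_k^{P-MR})^HC_k\,a_k^{P-MR}}\Big).$$ These formulas are meaningful: if $p_k>0$, $\mathcal M_k\neq\emptyset$ and, for each $l\in\mathcal M_k$, $\bar h_{kl}\ne0$ or $R_{kl}\ne0$, then $C_k^P$ is invertible and the denominator $(a_k^{P-MR})^HC_k\,a_k^{P-MR}$ is positive. -/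

import Mathlib

open MeasureTheory ProbabilityTheory Matrix
open scoped ComplexConjugate ComplexOrder

noncomputable section

namespace SCF

/-- The random vector `X` is circularly symmetric complex Gaussian `CN(m, C)`: it is Gaussian (as a
random vector of the underlying real vector space), has mean `m`, covariance matrix
`E[(X - m)(X - m)ᴴ] = C` and pseudo-covariance matrix `E[(X - m)(X - m)ᵀ] = 0`. -/
structure IsCN {Ω : Type*} [MeasurableSpace Ω] (P : Measure Ω) {n : ℕ}
    (X : Ω → Fin n → ℂ) (m : Fin n → ℂ) (C : Matrix (Fin n) (Fin n) ℂ) : Prop where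
  gaussian : HasGaussianLaw X P
  mean : ∀ a, ∫ ω, X ω a ∂P = m a
  cov : ∀ a b, ∫ ω, (X ω a - m a) * conj (X ω b - m b) ∂P = C a b
  pseudoCov : ∀ a b, ∫ ω, (X ω a - m a) * (X ω b - m b) ∂P = 0

/-- Deterministic parameters of the uplink of a cell-free network with `K` single-antenna UEs, `L`
APs of `N` antennas each, and pilots of length `τ`. UEs, APs, antennas and pilot symbols are
numbered from `0`. -/
structure Network (K L N τ : ℕ) where
  /-- transmit power of each UE -/
  p : Fin K → ℝ
  p_nonneg : ∀ i, 0 ≤ p i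
  /-- variance of the receiver noise -/
  σsq : ℝ
  σsq_pos : 0 < σsq
  /-- distortion factor of the DACs -/
  ρda : ℝ
  ρda_nonneg : 0 ≤ ρda
  ρda_lt_one : ρda < 1
  /-- distortion factor of the ADCs -/
  ρad : ℝ
  ρad_nonneg : 0 ≤ ρad
  ρad_lt_one : ρad < 1
  /-- large-scale fading (received power) between a UE and an AP -/
  β : Fin K → Fin L → ℝ
  β_nonneg : ∀ i l, 0 ≤ β i l
  /-- Rician factors -/
  κ : Fin K → Fin L → ℝ
  κ_nonneg : ∀ i l, 0 ≤ κ i l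
  /-- angles of arrival of the line-of-sight paths -/
  θ : Fin K → Fin L → ℝ
  /-- spatial correlation matrices of the non-line-of-sight parts -/
  R : Fin K → Fin L → Matrix (Fin N) (Fin N) ℂ
  R_psd : ∀ i l, (R i l).PosSemidef
  /-- index of the pilot assigned to each UE -/
  pilot : Fin K → Fin τ
  /-- cluster of APs that serve each UE -/
  M : Fin K → Finset (Fin L)

namespace Network

variable {K L N τ : ℕ} (W : Network K L N τ)

/-- The effective power `(1 - ρ_da) p_i`. -/
def pdd (i : Fin K) : ℝ := (1 - W.ρda) * W.p i

/-- Large-scale fading of the line-of-sight path. -/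
def βLOS (i : Fin K) (l : Fin L) : ℝ := W.κ i l * W.β i l / (W.κ i l + 1)

/-- Line-of-sight part of the channel: half-wavelength uniform linear array. -/
def hbar (i : Fin K) (l : Fin L) : Fin N → ℂ := fun n =>
  (Real.sqrt (W.βLOS i l) : ℂ) *
    Complex.exp (-Complex.I * ((n : ℕ) : ℂ) * (Real.pi : ℂ) * (Real.sin (W.θ i l) : ℂ))

/-- The UEs that share the pilot of UE `k`. -/
def PSet (k : Fin K) : Finset (Fin K) := Finset.univ.filter fun i => W.pilot i = W.pilot k

/-- The `LN × LN` block diagonal matrix with blocks `D_{kl} = I_N` if AP `l` serves UE `k` and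
`D_{kl} = 0` otherwise. -/
def D (k : Fin K) : Matrix (Fin N × Fin L) (Fin N × Fin L) ℂ :=
  blockDiagonal fun l => if l ∈ W.M k then 1 else 0

open Classical in
/-- The UEs `i` with `D_k D_i ≠ 0`. -/
def QSet (k : Fin K) : Finset (Fin K) := Finset.univ.filter fun i => W.D k * W.D i ≠ 0

/-- `H̄_l P̈ H̄_lᴴ + ∑ i, p̈_i R_{il}`. -/
def S (l : Fin L) : Matrix (Fin N) (Fin N) ℂ :=
  ∑ i, (W.pdd i : ℂ) • (vecMulVec (W.hbar i l) (star (W.hbar i l)) + W.R i l)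

/-- Covariance matrix of the effective noise at AP `l`. -/
def Cn (l : Fin L) : Matrix (Fin N) (Fin N) ℂ :=
  (((1 - W.ρad) ^ 2 * W.ρda / (1 - W.ρda) : ℝ) : ℂ) • W.S l
    + ((W.ρad * (1 - W.ρad) / (1 - W.ρda) : ℝ) : ℂ) • diagonal (diag (W.S l))
    + (((1 - W.ρad) * W.σsq : ℝ) : ℂ) • (1 : Matrix (Fin N) (Fin N) ℂ)

/-- The matrix `Ψ` of the pilot used by UE `k`, at AP `l`. -/
def Psi (k : Fin K) (l : Fin L) : Matrix (Fin N) (Fin N) ℂ :=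
  (((1 - W.ρad) ^ 2 : ℝ) : ℂ) • ∑ i ∈ W.PSet k, ((W.pdd i * τ : ℝ) : ℂ) • W.R i l + W.Cn l

/-- The pilot sequences: columns of the `τ × τ` discrete Fourier transform matrix. -/
def φ (_W : Network K L N τ) (t : Fin τ) : Fin τ → ℂ := fun t' =>
  Complex.exp (-Complex.I * 2 * (Real.pi : ℂ) * ((t : ℕ) : ℂ) * ((t' : ℕ) : ℂ) / (τ : ℂ))

/-! Closed-form quantities. -/

/-- `b_{kl}^i`; the vector `b_k^i` is its restriction to the cluster of UE `k`. -/
def b (k i : Fin K) (l : Fin L) : ℂ :=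
  (((1 - W.ρad) ^ 2 * τ * Real.sqrt (W.pdd k * W.pdd i) : ℝ) : ℂ)
    * trace (W.R i l * (W.Psi k l)⁻¹ * W.R k l)

/-- `λ_{kl}^i`. -/
def lam (k i : Fin K) (l : Fin L) : ℂ := star (W.hbar k l) ⬝ᵥ W.hbar i l

/-- `c_{kl}^i`. -/
def c (k i : Fin K) (l : Fin L) : ℂ :=
  (((1 - W.ρad) ^ 2 * τ * W.pdd k : ℝ) : ℂ)
      * trace (W.R i l * W.R k l * (W.Psi k l)⁻¹ * W.R k l)
    + star (W.hbar k l) ⬝ᵥ (W.R i l *ᵥ W.hbar k l)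
    + (((1 - W.ρad) ^ 2 * τ * W.pdd k : ℝ) : ℂ)
      * (star (W.hbar i l) ⬝ᵥ ((W.R k l * (W.Psi k l)⁻¹ * W.R k l) *ᵥ W.hbar i l))

/-- `d_{kl}`. -/
def d (k : Fin K) (l : Fin L) : ℂ :=
  let ΔR : Matrix (Fin N) (Fin N) ℂ := diagonal (diag (∑ i, (W.pdd i : ℂ) • W.R i l))
  ((W.ρad * (1 - W.ρad) / (1 - W.ρda) : ℝ) : ℂ) * (star (W.hbar k l) ⬝ᵥ (ΔR *ᵥ W.hbar k l))
    + ((W.ρad * (1 - W.ρad) ^ 3 / (1 - W.ρda) * τ * W.pdd k : ℝ) : ℂ)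
      * trace (ΔR * W.R k l * (W.Psi k l)⁻¹ * W.R k l)
    + (((1 - W.ρad) * (W.σsq + W.ρad / (1 - W.ρda)
          * ∑ i, W.pdd i * W.β i l * W.κ i l / (W.κ i l + 1)) : ℝ) : ℂ)
      * (star (W.hbar k l) ⬝ᵥ W.hbar k l
        + (((1 - W.ρad) ^ 2 * τ * W.pdd k : ℝ) : ℂ)
          * trace (W.R k l * (W.Psi k l)⁻¹ * W.R k l))

/-- The vector `λ_k^i`, indexed by the APs that serve UE `k`. -/
def lamV (k i : Fin K) : W.M k → ℂ := fun l => W.lam k i l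

/-- The vector `b_k^i`, indexed by the APs that serve UE `k`. -/
def bV (k i : Fin K) : W.M k → ℂ := fun l => W.b k i l

/-- The matrix `C_k` with the sum over all UEs replaced by the sum over the set `Q` of UEs. -/
def CMat (k : Fin K) (Q : Finset (Fin K)) : Matrix (W.M k) (W.M k) ℂ :=
  (((1 - W.ρad) ^ 2 / (1 - W.ρda) : ℝ) : ℂ) •
      (∑ i ∈ Q, (W.pdd i : ℂ) •
          (vecMulVec (W.lamV k i) (star (W.lamV k i)) + diagonal fun l : W.M k => W.c k i l)
        + ∑ i ∈ W.PSet k ∩ Q, (W.pdd i : ℂ) •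
          (vecMulVec (W.bV k i) (star (W.bV k i)) + vecMulVec (W.bV k i) (star (W.lamV k i))
            + vecMulVec (W.lamV k i) (star (W.bV k i))))
    - (((1 - W.ρad) ^ 2 * W.pdd k : ℝ) : ℂ) •
      vecMulVec (W.lamV k k + W.bV k k) (star (W.lamV k k + W.bV k k))
    + diagonal fun l : W.M k => W.d k l

/-- The matrix `C_k`. -/
def C (k : Fin K) : Matrix (W.M k) (W.M k) ℂ := W.CMat k Finset.univ

/-- The matrix `C_k^P`. -/
def CP (k : Fin K) : Matrix (W.M k) (W.M k) ℂ := W.CMat k (W.QSet k)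

end Network

/-- The elementary sources of randomness. -/
inductive Source (K L τ : ℕ) : Type
  /-- non-line-of-sight part of the channel between a UE and an AP -/
  | chan (i : Fin K) (l : Fin L)
  /-- effective noise at an AP during one pilot symbol -/
  | pilotNoise (l : Fin L) (t : Fin τ)
  /-- data symbol of a UE -/
  | sig (i : Fin K)
  /-- DAC noise of a UE in the data phase -/
  | dac (i : Fin K)
  /-- receiver noise at an AP in the data phase -/
  | recv (l : Fin L)
  /-- ADC noise at an AP in the data phase -/
  | adc (l : Fin L)

/-- Dimension of a source: `N` for the vectors at an AP, `1` for the scalars at a UE. -/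
def Source.dim {K L τ : ℕ} (N : ℕ) : Source K L τ → ℕ
  | .chan _ _ => N
  | .pilotNoise _ _ => N
  | .sig _ => 1
  | .dac _ => 1
  | .recv _ => N
  | .adc _ => N

/-- A family of random vectors on `Ω`, one for each source. -/
abbrev Sources (K L N τ : ℕ) (Ω : Type*) : Type _ :=
  (s : Source K L τ) → Ω → Fin (s.dim N) → ℂ

namespace Network

variable {K L N τ : ℕ} (W : Network K L N τ) {Ω : Type*} [MeasurableSpace Ω]
  (P : Measure Ω) (X : Sources K L N τ Ω)

/-- Non-line-of-sight part of the channel. -/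
def hw (_W : Network K L N τ) (X : Sources K L N τ Ω) (i : Fin K) (l : Fin L) :
    Ω → Fin N → ℂ := X (.chan i l)

/-- The channel `h_{il} = h̄_{il} + h_{w,il}`. -/
def h (i : Fin K) (l : Fin L) : Ω → Fin N → ℂ := fun ω => W.hbar i l + W.hw X i l ω

/-- Data symbol `s_i` (a scalar). -/
def s (_W : Network K L N τ) (X : Sources K L N τ Ω) (i : Fin K) : Ω → ℂ :=
  fun ω => X (.sig i) ω (0 : Fin 1)

/-- DAC noise `n_{da,i}` of the data phase (a scalar). -/
def nda (_W : Network K L N τ) (X : Sources K L N τ Ω) (i : Fin K) : Ω → ℂ :=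
  fun ω => X (.dac i) ω (0 : Fin 1)

/-- Receiver noise `n_{an,l}` of the data phase. -/
def nan (_W : Network K L N τ) (X : Sources K L N τ Ω) (l : Fin L) : Ω → Fin N → ℂ := X (.recv l)

/-- ADC noise `n_{ad,l}` of the data phase. -/
def nad (_W : Network K L N τ) (X : Sources K L N τ Ω) (l : Fin L) : Ω → Fin N → ℂ := X (.adc l)

/-- Input of the ADCs at AP `l` in the data phase:
`∑ i, h_{il} (√(1 - ρ_da) s_i + n_{da,i}) + n_{an,l}`. -/
def adcIn (l : Fin L) : Ω → Fin N → ℂ := fun ω =>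
  ∑ i, ((Real.sqrt (1 - W.ρda) : ℂ) * W.s X i ω + W.nda X i ω) • W.h X i l ω + W.nan X l ω

/-- Covariance matrix `ρ_ad (1 - ρ_ad) diag(E[x xᴴ])` of the ADC noise for the ADC input `x`. -/
def Cad (l : Fin L) : Matrix (Fin N) (Fin N) ℂ :=
  ((W.ρad * (1 - W.ρad) : ℝ) : ℂ) •
    diagonal fun n => ∫ ω, W.adcIn X l ω n * conj (W.adcIn X l ω n) ∂P

/-- The statistical model: all sources are independent, circularly symmetric complex Gaussian with
mean zero, and have the covariance matrices of the system model. -/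
structure IsModel : Prop where
  indep : iIndepFun X P
  chan : ∀ i l, IsCN P (W.hw X i l) 0 (W.R i l)
  pilotNoise : ∀ l t, IsCN (n := N) P (X (.pilotNoise l t)) 0 (W.Cn l)
  sig : ∀ i, IsCN (n := 1) P (X (.sig i)) 0 ((W.p i : ℂ) • 1)
  dac : ∀ i, IsCN (n := 1) P (X (.dac i)) 0 (((W.ρda * W.p i : ℝ) : ℂ) • 1)
  recv : ∀ l, IsCN P (W.nan X l) 0 ((W.σsq : ℂ) • 1)
  adc : ∀ l, IsCN P (W.nad X l) 0 (W.Cad P X l)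

/-! Pilot phase and channel estimation. -/

/-- The quantized received pilot matrix at AP `l`. -/
def Z (l : Fin L) : Ω → Matrix (Fin N) (Fin τ) ℂ := fun ω =>
  ((1 - W.ρad : ℝ) : ℂ) •
      ∑ i, (Real.sqrt (W.pdd i) : ℂ) • vecMulVec (W.h X i l ω) (W.φ (W.pilot i))
    + Matrix.of fun n t => X (.pilotNoise l t) ω n

/-- The received pilot matrix correlated with the pilot of UE `k`: `Z_l φ* / √τ`. -/
def z (k : Fin K) (l : Fin L) : Ω → Fin N → ℂ := fun ω =>
  ((1 / Real.sqrt τ : ℝ) : ℂ) • (W.Z X l ω *ᵥ star (W.φ (W.pilot k)))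

/-- The correlated pilot signal without its known line-of-sight part; since the pilots are
orthogonal, this is `(1 - ρ_ad) ∑ i ∈ P_k, √(p̈_i τ) h_{w,il}` plus noise. -/
def zw (k : Fin K) (l : Fin L) : Ω → Fin N → ℂ := fun ω =>
  W.z X k l ω - ((1 - W.ρad : ℝ) : ℂ) •
    ∑ i ∈ W.PSet k, (Real.sqrt (W.pdd i * τ) : ℂ) • W.hbar i l

/-- The MMSE estimate `ĥ_{kl} = h̄_{kl} + (1 - ρ_ad) √(p̈_k τ) R_{kl} Ψ⁻¹ zw`. -/
def hhat (k : Fin K) (l : Fin L) : Ω → Fin N → ℂ := fun ω =>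
  W.hbar k l + (((1 - W.ρad) * Real.sqrt (W.pdd k * τ) : ℝ) : ℂ) •
    ((W.R k l * (W.Psi k l)⁻¹) *ᵥ W.zw X k l ω)

/-! Data phase. -/

/-- The effective noise `n_l` at AP `l` in the data phase. -/
def nEff (l : Fin L) : Ω → Fin N → ℂ := fun ω =>
  ((1 - W.ρad : ℝ) : ℂ) • ∑ i, W.nda X i ω • W.h X i l ω
    + ((1 - W.ρad : ℝ) : ℂ) • W.nan X l ω + W.nad X l ω

/-- `g_{ki} = [v_{kl}ᴴ h_{il} | l ∈ M_k]ᵀ`, for the combining vectors `v`. -/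
def g (v : Fin K → Fin L → Ω → Fin N → ℂ) (k i : Fin K) : Ω → W.M k → ℂ :=
  fun ω l => star (v k l ω) ⬝ᵥ W.h X i l ω

/-- `f_k = [v_{kl}ᴴ n_l | l ∈ M_k]ᵀ`, for the combining vectors `v`. -/
def f (v : Fin K → Fin L → Ω → Fin N → ℂ) (k : Fin K) : Ω → W.M k → ℂ :=
  fun ω l => star (v k l ω) ⬝ᵥ W.nEff X l ω

end Network

/-- Entrywise expectation of a random vector. -/
def expVec {Ω ι : Type*} [MeasurableSpace Ω] (P : Measure Ω) (Y : Ω → ι → ℂ) : ι → ℂ :=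
  fun l => ∫ ω, Y ω l ∂P

/-- `E[Y Yᴴ]`. -/
def expOuter {Ω ι : Type*} [MeasurableSpace Ω] (P : Measure Ω) (Y : Ω → ι → ℂ) : Matrix ι ι ℂ :=
  Matrix.of fun l l' => ∫ ω, Y ω l * conj (Y ω l') ∂P

namespace Network

variable {K L N τ : ℕ} (W : Network K L N τ) {Ω : Type*} [MeasurableSpace Ω]
  (P : Measure Ω) (X : Sources K L N τ Ω)

/-- The uplink spectral efficiency of UE `k` in the distributed scheme, for coherence blocks of
`τc` symbols, combining vectors `v` at the APs and the weighting vector `a` at the CPU. -/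
def ulSE (τc : ℕ) (v : Fin K → Fin L → Ω → Fin N → ℂ) (k : Fin K) (a : W.M k → ℂ) : ℝ :=
  let sigPow : ℝ := (1 - W.ρad) ^ 2 * W.pdd k * ‖star a ⬝ᵥ expVec P (W.g X v k k)‖ ^ 2
  (1 - (τ : ℝ) / (τc : ℝ)) * Real.logb 2 (1 + sigPow /
    ((1 - W.ρad) ^ 2 * ∑ i, W.pdd i * ∫ ω, ‖star a ⬝ᵥ W.g X v k i ω‖ ^ 2 ∂P
      - sigPow + (star a ⬝ᵥ (expOuter P (W.f X v k) *ᵥ a)).re))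

/-- The partial large-scale fading decoding vector for MRC, in terms of expectations:
`[diag(d_{kl}) + (1 - ρ_ad)² / (1 - ρ_da) ∑ i ∈ Q_k, p̈_i E[g_{ki} g_{ki}ᴴ]
  - (1 - ρ_ad)² p̈_k E[g_{kk}] E[g_{kk}ᴴ]]⁻¹ E[g_{kk}]`. -/
def aPMR (k : Fin K) : W.M k → ℂ :=
  let g := W.g X (W.hhat X) k
  ((diagonal fun l : W.M k => W.d k l)
      + (((1 - W.ρad) ^ 2 / (1 - W.ρda) : ℝ) : ℂ) •
        ∑ i ∈ W.QSet k, (W.pdd i : ℂ) • expOuter P (g i)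
      - (((1 - W.ρad) ^ 2 * W.pdd k : ℝ) : ℂ) •
        vecMulVec (expVec P (g k)) (star (expVec P (g k))))⁻¹ *ᵥ expVec P (g k)

end Network

end SCF

end

/-! The channels and their estimates are affine in one jointly Gaussian vector, so every expectation
in the spectral efficiency is a Gaussian moment of order at most four in these, combined with second
moments of independent data-phase noise.

Subtracting the known line-of-sight part from the correlated pilot leaves a vector with covariance
Ψ. The random part of the estimate then has covariance proportional to RΨ⁻¹R, and it is correlated
with the channel of UE i exactly through the shared pilots. This gives E[g_ki] = λ + b for
pilot-sharing UEs and E[g_ki] = λ otherwise (`expect_gRV`). For E[g_ki g_kiᴴ], Isserlis' formula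
applies: one pairing rebuilds the product of means, one gives c and needs equal APs, and the third
vanishes by circular symmetry. Hence the covariance of g_ki is Λ(c) (`expect_gRV_mul_star_gRV`).

The combined noise f_k is linear in the data-phase noises, with coefficients that depend only on
channels and pilot noise. Independence therefore yields E[f fᴴ] (`expOuter_f`): the DAC noise
repeats the matrices E[g gᴴ] with weight ρ_da/(1-ρ_da), and the receiver and ADC noises give Λ(d).
Since 1 + ρ_da/(1-ρ_da) = 1/(1-ρ_da), the denominator is the quadratic form of C_k (`CMat_eq`,
`ulSE_eq`).

For positivity, the term i = k outweighs the subtracted rank-one matrix because 1/(1-ρ_da) ≥ 1, the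
other terms are positive semidefinite, and Λ(d) is positive definite thanks to the receiver noise
(`CMat_posDef`). -/

noncomputable section

namespace SCF

open scoped ENNReal

/-! ### Random variables with all moments, as a commutative star algebra: integrability is automatic
and moments are computed by `ring`. -/

section MomentAlgebra

variable {Ω : Type*} [MeasurableSpace Ω] (P : Measure Ω) [IsProbabilityMeasure P]

/-- The complex random variables with finite absolute moments of all orders. -/
def momentAlgebra : StarSubalgebra ℂ (Ω → ℂ) where
  carrier := {Y | ∀ p : ℝ≥0∞, p ≠ ∞ → MemLp Y p P}
  mul_mem' {a b} ha hb p hp := by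
    -- Hölder with 1/(2p) + 1/(2p) = 1/p: a product costs a doubled exponent, which is why all
    -- finite exponents are required at once.
    have : ENNReal.HolderTriple (p * 2) (p * 2) p := by
      constructor
      rw [ENNReal.mul_inv (by simp) (by simp), ← mul_add, ENNReal.inv_two_add_inv_two, mul_one]
    exact MemLp.mul (p := p * 2) (q := p * 2)
      (hb _ (ENNReal.mul_ne_top hp (by simp))) (ha _ (ENNReal.mul_ne_top hp (by simp)))
  add_mem' ha hb p hp := (ha p hp).add (hb p hp)
  algebraMap_mem' c p _ := memLp_const c
  star_mem' ha p hp := (ha p hp).star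

variable {P}

lemma integrable_of_mem (y : momentAlgebra P) : Integrable (y : Ω → ℂ) P :=
  memLp_one_iff_integrable.1 (y.2 1 (by simp))

/-- Constant random variables. -/
abbrev constRV (P : Measure Ω) [IsProbabilityMeasure P] (c : ℂ) : momentAlgebra P :=
  algebraMap ℂ (momentAlgebra P) c

/-- Expectation as a linear functional. -/
def expect (P : Measure Ω) [IsProbabilityMeasure P] : momentAlgebra P →ₗ[ℂ] ℂ where
  toFun y := ∫ ω, y.1 ω ∂P
  map_add' y z := integral_add (integrable_of_mem y) (integrable_of_mem z)
  map_smul' c _ := integral_const_mul c _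

lemma expect_apply (y : momentAlgebra P) : expect P y = ∫ ω, (y : Ω → ℂ) ω ∂P := rfl

@[simp] lemma expect_const_mul (c : ℂ) (y : momentAlgebra P) :
    expect P (constRV P c * y) = c * expect P y := by
  rw [← Algebra.smul_def, map_smul, smul_eq_mul]

@[simp] lemma expect_const (c : ℂ) : expect P (constRV P c) = c := by
  have : expect P (constRV P c) = ∫ _, c ∂P := rfl
  simp [this]

@[simp] lemma expect_one : expect P 1 = 1 := by
  simpa using expect_const (P := P) 1

@[simp] lemma expect_star (y : momentAlgebra P) : expect P (star y) = conj (expect P y) := by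
  exact integral_conj

@[simp] lemma star_constRV (c : ℂ) : star (constRV P c) = constRV P (conj c) :=
  (algebraMap_star_comm c).symm

end MomentAlgebra

/-! ### Third and fourth moments of Gaussian vectors. -/

section GaussianMoments

/-- The function is the moment generating function of a centred Gaussian of variance v, whose
derivatives at 0 are the moments. -/
lemma deriv_iterates_exp_sq (v : ℝ) :
    iteratedDeriv 3 (fun t : ℝ => Real.exp (v * t ^ 2 / 2)) 0 = 0 ∧
      iteratedDeriv 4 (fun t : ℝ => Real.exp (v * t ^ 2 / 2)) 0 = 3 * v ^ 2 := by
  have hE : ∀ t : ℝ, HasDerivAt (fun t : ℝ => Real.exp (v * t ^ 2 / 2))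
      (v * t * Real.exp (v * t ^ 2 / 2)) t := fun t => by
    have h : HasDerivAt (fun t : ℝ => v * t ^ 2 / 2) (v * t) t := by
      have := ((hasDerivAt_pow 2 t).const_mul v).div_const 2
      exact this.congr_deriv (by push_cast; ring)
    exact mul_comm (v * t) _ ▸ h.exp
  -- Each derivative is again a polynomial times the exponential, with q replaced by q' + q·vt.
  have hP : ∀ (q : ℝ → ℝ) (q' : ℝ → ℝ), (∀ t, HasDerivAt q (q' t) t) →
      deriv (fun t => q t * Real.exp (v * t ^ 2 / 2)) =
        fun t => (q' t + q t * (v * t)) * Real.exp (v * t ^ 2 / 2) := fun q q' hq => by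
    funext t
    exact ((hq t).fun_mul (hE t)).deriv.trans (by ring)
  have h1 : deriv (fun t : ℝ => Real.exp (v * t ^ 2 / 2)) =
      fun t => (v * t) * Real.exp (v * t ^ 2 / 2) := funext fun t => (hE t).deriv
  have h2 := hP (fun t => v * t) (fun _ => v) fun t => by
    simpa using (hasDerivAt_id t).const_mul v
  have h3 := hP (fun t => v + v * t * (v * t)) (fun t => v * (v * t) + v * t * v) fun t => by
    have h : HasDerivAt (fun t : ℝ => v * t) v t := by
      simpa using (hasDerivAt_id t).const_mul v
    simpa using (h.mul h).const_add v
  have h4 := hP (fun t => v * (v * t) + v * t * v + (v + v * t * (v * t)) * (v * t))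
      (fun t => v * v + v * v + ((v * (v * t) + v * t * v) * (v * t)
        + (v + v * t * (v * t)) * v)) fun t => by
    have h : HasDerivAt (fun t : ℝ => v * t) v t := by
      simpa using (hasDerivAt_id t).const_mul v
    exact ((h.const_mul v).add (h.mul_const v)).add (((h.mul h).const_add v).mul h)
  simp only [iteratedDeriv_succ, iteratedDeriv_zero, h1, h2, h3, h4]
  constructor
  · simp
  · simp
    ring

variable {Ω : Type*} [MeasurableSpace Ω] {P : Measure Ω}

lemma integral_pow_of_hasGaussianLaw {Y : Ω → ℝ} (hY : HasGaussianLaw Y P)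
    (h0 : ∫ ω, Y ω ∂P = 0) :
    ∫ ω, Y ω ^ 3 ∂P = 0 ∧ ∫ ω, Y ω ^ 4 ∂P = 3 * (∫ ω, Y ω ^ 2 ∂P) ^ 2 := by
  have : IsProbabilityMeasure P := hY.isProbabilityMeasure
  have hvar : Var[Y; P] = ∫ ω, Y ω ^ 2 ∂P := by
    rw [variance_eq_sub hY.memLp_two, h0]
    simp
  have hmap := hY.map_eq_gaussianReal
  rw [h0] at hmap
  have hset : integrableExpSet Y P = Set.univ := by
    ext t
    have ht : Integrable (fun x => Real.exp (t * x)) (P.map Y) :=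
      hmap ▸ integrable_exp_mul_gaussianReal t
    exact iff_of_true (ht.comp_aemeasurable hY.aemeasurable) trivial
  have hmgf : mgf Y P = fun t => Real.exp ((∫ ω, Y ω ^ 2 ∂P) * t ^ 2 / 2) := by
    funext t
    rw [mgf_gaussianReal hmap, Real.coe_toNNReal _ (variance_nonneg _ _), hvar]
    simp
  have hmem : (0 : ℝ) ∈ interior (integrableExpSet Y P) := by simp [hset]
  have h3 := iteratedDeriv_mgf_zero hmem 3
  have h4 := iteratedDeriv_mgf_zero hmem 4
  rw [hmgf] at h3 h4
  rw [(deriv_iterates_exp_sq _).1] at h3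
  rw [(deriv_iterates_exp_sq _).2] at h4
  exact ⟨h3.symm, h4.symm⟩

variable {E : Type*} [NormedAddCommGroup E] [NormedSpace ℝ E] [IsProbabilityMeasure P]

/-- The complex random variables that are real linear functions of `X`. -/
def linearSpan (P : Measure Ω) [IsProbabilityMeasure P] (X : Ω → E) :
    Submodule ℂ (momentAlgebra P) where
  carrier := {y | ∃ T : E →L[ℝ] ℂ, ∀ ω, (y : Ω → ℂ) ω = T (X ω)}
  add_mem' := by
    rintro y z ⟨T, hT⟩ ⟨T', hT'⟩
    exact ⟨T + T', fun ω => by simp [← hT, ← hT']⟩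
  zero_mem' := ⟨0, fun ω => by simp⟩
  smul_mem' := by
    rintro c y ⟨T, hT⟩
    exact ⟨c • T, fun ω => by simp [← hT]⟩

variable {X : Ω → E}

lemma star_mem_linearSpan {y : momentAlgebra P} (hy : y ∈ linearSpan P X) :
    star y ∈ linearSpan P X := by
  obtain ⟨T, hT⟩ := hy
  exact ⟨Complex.conjCLE.toContinuousLinearMap.comp T, fun ω => by simp [← hT]⟩

lemma const_mul_mem_linearSpan (c : ℂ) {y : momentAlgebra P} (hy : y ∈ linearSpan P X) :
    constRV P c * y ∈ linearSpan P X := by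
  rw [← Algebra.smul_def]
  exact Submodule.smul_mem _ _ hy

variable [MeasurableSpace E] [BorelSpace E]

lemma exists_mem_linearSpan (hX : HasGaussianLaw X P) (T : E →L[ℝ] ℂ) :
    ∃ y ∈ linearSpan P X, ∀ ω, (y : Ω → ℂ) ω = T (X ω) :=
  ⟨⟨fun ω => T (X ω), fun _ hp => (hX.map_fun T).memLp hp⟩, ⟨T, fun _ => rfl⟩, fun _ => rfl⟩

variable [CompleteSpace E] [SecondCountableTopology E]

lemma expect_linearSpan (hX : HasGaussianLaw X P) (h0 : ∫ ω, X ω ∂P = 0) {y : momentAlgebra P}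
    (hy : y ∈ linearSpan P X) : expect P y = 0 := by
  obtain ⟨T, hT⟩ := hy
  rw [expect_apply, integral_congr_ae (.of_forall hT), T.integral_comp_comm hX.integrable, h0,
    map_zero]

/-- Decomposition into real and imaginary part, such that all real combinations of the two are
Gaussian with mean zero. -/
lemma exists_re_im_linearSpan (hX : HasGaussianLaw X P) (h0 : ∫ ω, X ω ∂P = 0)
    {y : momentAlgebra P} (hy : y ∈ linearSpan P X) :
    ∃ a b : momentAlgebra P, y = a + constRV P Complex.I * b ∧
      ∀ s t : ℝ, expect P ((constRV P s * a + constRV P t * b) ^ 3) = 0 ∧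
        expect P ((constRV P s * a + constRV P t * b) ^ 4) =
          3 * expect P ((constRV P s * a + constRV P t * b) ^ 2) ^ 2 := by
  obtain ⟨T, hT⟩ := hy
  obtain ⟨a, -, ha⟩ := exists_mem_linearSpan hX
    (Complex.ofRealCLM.comp (Complex.reCLM.comp T))
  obtain ⟨b, -, hb⟩ := exists_mem_linearSpan hX
    (Complex.ofRealCLM.comp (Complex.imCLM.comp T))
  refine ⟨a, b, ?_, fun s t => ?_⟩
  · ext ω
    change (y : Ω → ℂ) ω = (a : Ω → ℂ) ω + Complex.I * (b : Ω → ℂ) ω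
    rw [hT, ha, hb]
    simp [mul_comm Complex.I]
  · have hG := hX.map_fun (s • Complex.reCLM.comp T + t • Complex.imCLM.comp T)
    set S := s • Complex.reCLM.comp T + t • Complex.imCLM.comp T with hS
    have hG0 : ∫ ω, S (X ω) ∂P = 0 := by
      rw [S.integral_comp_comm hX.integrable, h0, map_zero]
    have hm := integral_pow_of_hasGaussianLaw hG hG0
    have hn : ∀ n : ℕ, expect P ((constRV P s * a + constRV P t * b) ^ n) =
        ((∫ ω, (S (X ω)) ^ n ∂P : ℝ) : ℂ) := fun n => by
      rw [expect_apply, ← integral_complex_ofReal]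
      refine integral_congr_ae (.of_forall fun ω => ?_)
      change ((s : ℂ) * (a : Ω → ℂ) ω + (t : ℂ) * (b : Ω → ℂ) ω) ^ n = _
      rw [ha, hb]
      simp [hS]
    rw [hn, hn, hn, hm.1, hm.2]
    simp

/-- The moment identities hold for sa + tb with s, t real. Both sides are polynomials in (s, t), so
the coefficients agree and the identities persist at the complex point (1, i). No circular symmetry
is used. -/
lemma expect_pow_linearSpan (hX : HasGaussianLaw X P) (h0 : ∫ ω, X ω ∂P = 0)
    {y : momentAlgebra P} (hy : y ∈ linearSpan P X) :
    expect P (y ^ 3) = 0 ∧ expect P (y ^ 4) = 3 * expect P (y ^ 2) ^ 2 := by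
  obtain ⟨a, b, rfl, h⟩ := exists_re_im_linearSpan hX h0 hy
  have e2 : ∀ s t : ℂ, expect P ((constRV P s * a + constRV P t * b) ^ 2) =
      s ^ 2 * expect P (a ^ 2) + 2 * s * t * expect P (a * b) + t ^ 2 * expect P (b ^ 2) := by
    intro s t
    rw [show (constRV P s * a + constRV P t * b) ^ 2 = constRV P (s ^ 2) * a ^ 2
      + constRV P (2 * s * t) * (a * b) + constRV P (t ^ 2) * b ^ 2 by
        simp only [constRV, map_mul, map_pow, map_ofNat]; ring]
    simp only [map_add, expect_const_mul]
  have e3 : ∀ s t : ℂ, expect P ((constRV P s * a + constRV P t * b) ^ 3) =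
      s ^ 3 * expect P (a ^ 3) + 3 * s ^ 2 * t * expect P (a ^ 2 * b)
        + 3 * s * t ^ 2 * expect P (a * b ^ 2) + t ^ 3 * expect P (b ^ 3) := by
    intro s t
    rw [show (constRV P s * a + constRV P t * b) ^ 3 = constRV P (s ^ 3) * a ^ 3
      + constRV P (3 * s ^ 2 * t) * (a ^ 2 * b) + constRV P (3 * s * t ^ 2) * (a * b ^ 2)
      + constRV P (t ^ 3) * b ^ 3 by
        simp only [constRV, map_mul, map_pow, map_ofNat]; ring]
    simp only [map_add, expect_const_mul]
  have e4 : ∀ s t : ℂ, expect P ((constRV P s * a + constRV P t * b) ^ 4) =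
      s ^ 4 * expect P (a ^ 4) + 4 * s ^ 3 * t * expect P (a ^ 3 * b)
        + 6 * s ^ 2 * t ^ 2 * expect P (a ^ 2 * b ^ 2) + 4 * s * t ^ 3 * expect P (a * b ^ 3)
        + t ^ 4 * expect P (b ^ 4) := by
    intro s t
    rw [show (constRV P s * a + constRV P t * b) ^ 4 = constRV P (s ^ 4) * a ^ 4
      + constRV P (4 * s ^ 3 * t) * (a ^ 3 * b) + constRV P (6 * s ^ 2 * t ^ 2) * (a ^ 2 * b ^ 2)
      + constRV P (4 * s * t ^ 3) * (a * b ^ 3) + constRV P (t ^ 4) * b ^ 4 by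
        simp only [constRV, map_mul, map_pow, map_ofNat]; ring]
    simp only [map_add, expect_const_mul]
  simp only [e2, e3, e4] at h
  -- Five points determine the coefficients: (1,0) and (0,1) give the pure moments, (1,±1) separate
  -- even from odd mixed terms, and (1,2) separates a³b from ab³.
  have h10 := h 1 0
  have h01 := h 0 1
  have h11 := h 1 1
  have h1m := h 1 (-1)
  have h12 := h 1 2
  push_cast at h10 h01 h11 h1m h12
  have hI2 : Complex.I ^ 2 = -1 := Complex.I_sq
  have hI3 : Complex.I ^ 3 = -Complex.I := Complex.I_pow_three
  have hI4 : Complex.I ^ 4 = 1 := Complex.I_pow_four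
  have hone : a + constRV P Complex.I * b = constRV P 1 * a + constRV P Complex.I * b := by simp
  rw [hone, e2, e3, e4, hI2, hI3, hI4]
  obtain ⟨a3, a4⟩ := h10
  obtain ⟨b3, b4⟩ := h01
  obtain ⟨p3, p4⟩ := h11
  obtain ⟨m3, m4⟩ := h1m
  obtain ⟨-, t4⟩ := h12
  ring_nf at a3 a4 b3 b4 p3 p4 m3 m4 t4
  have x21 : expect P (a ^ 2 * b) = 0 := by linear_combination (p3 - m3) / 6 - b3 / 3
  have x12 : expect P (a * b ^ 2) = 0 := by linear_combination (p3 + m3) / 6 - a3 / 3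
  have x22 : expect P (a ^ 2 * b ^ 2) =
      expect P (a ^ 2) * expect P (b ^ 2) + 2 * expect P (a * b) ^ 2 := by
    linear_combination (p4 + m4) / 12 - a4 / 6 - b4 / 6
  have x13 : expect P (a * b ^ 3) = 3 * expect P (a * b) * expect P (b ^ 2) := by
    linear_combination (t4 - a4 - 16 * b4 - 24 * x22 - (p4 - m4)) / 24
  have x31 : expect P (a ^ 3 * b) = 3 * expect P (a * b) * expect P (a ^ 2) := by
    linear_combination (p4 - m4) / 8 - x13
  constructor
  · linear_combination a3 - Complex.I * b3 + 3 * Complex.I * x21 - 3 * x12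
  · linear_combination a4 + b4 + 4 * Complex.I * x31 - 6 * x22 - 4 * Complex.I * x13
      - 12 * expect P (a * b) ^ 2 * hI2

lemma expect_mul_three_linearSpan (hX : HasGaussianLaw X P) (h0 : ∫ ω, X ω ∂P = 0)
    {y₁ y₂ y₃ : momentAlgebra P} (h₁ : y₁ ∈ linearSpan P X) (h₂ : y₂ ∈ linearSpan P X)
    (h₃ : y₃ ∈ linearSpan P X) : expect P (y₁ * y₂ * y₃) = 0 := by
  have h : ∀ s t : ℂ, expect P ((y₁ + constRV P s * y₂ + constRV P t * y₃) ^ 3) = 0 := fun s t =>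
    (expect_pow_linearSpan hX h0 (add_mem (add_mem h₁ (const_mul_mem_linearSpan s h₂))
      (const_mul_mem_linearSpan t h₃))).1
  -- Polarization with the sign of y₁ fixed: four sign choices times 3! give 24.
  have key : constRV P 24 * (y₁ * y₂ * y₃) =
      (y₁ + constRV P 1 * y₂ + constRV P 1 * y₃) ^ 3
      - (y₁ + constRV P 1 * y₂ + constRV P (-1) * y₃) ^ 3
      - (y₁ + constRV P (-1) * y₂ + constRV P 1 * y₃) ^ 3
      + (y₁ + constRV P (-1) * y₂ + constRV P (-1) * y₃) ^ 3 := by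
    simp only [constRV, map_neg, map_one, map_ofNat]
    ring
  have := congrArg (expect P) key
  simp only [map_add, map_sub, expect_const_mul, h] at this
  simpa using this

/-- Isserlis' theorem for four factors. -/
lemma expect_mul_four_linearSpan (hX : HasGaussianLaw X P) (h0 : ∫ ω, X ω ∂P = 0)
    {y₁ y₂ y₃ y₄ : momentAlgebra P} (h₁ : y₁ ∈ linearSpan P X) (h₂ : y₂ ∈ linearSpan P X)
    (h₃ : y₃ ∈ linearSpan P X) (h₄ : y₄ ∈ linearSpan P X) :
    expect P (y₁ * y₂ * y₃ * y₄) = expect P (y₁ * y₂) * expect P (y₃ * y₄)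
      + expect P (y₁ * y₃) * expect P (y₂ * y₄) + expect P (y₁ * y₄) * expect P (y₂ * y₃) := by
  have h : ∀ r s t : ℂ,
      expect P ((y₁ + constRV P r * y₂ + constRV P s * y₃ + constRV P t * y₄) ^ 4) =
        3 * (expect P (y₁ ^ 2) + r ^ 2 * expect P (y₂ ^ 2) + s ^ 2 * expect P (y₃ ^ 2)
          + t ^ 2 * expect P (y₄ ^ 2) + 2 * r * expect P (y₁ * y₂) + 2 * s * expect P (y₁ * y₃)
          + 2 * t * expect P (y₁ * y₄) + 2 * r * s * expect P (y₂ * y₃)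
          + 2 * r * t * expect P (y₂ * y₄) + 2 * s * t * expect P (y₃ * y₄)) ^ 2 := by
    intro r s t
    rw [(expect_pow_linearSpan hX h0 (add_mem (add_mem (add_mem h₁
      (const_mul_mem_linearSpan r h₂)) (const_mul_mem_linearSpan s h₃))
      (const_mul_mem_linearSpan t h₄))).2]
    rw [show (y₁ + constRV P r * y₂ + constRV P s * y₃ + constRV P t * y₄) ^ 2 =
      y₁ ^ 2 + constRV P (r ^ 2) * y₂ ^ 2 + constRV P (s ^ 2) * y₃ ^ 2
        + constRV P (t ^ 2) * y₄ ^ 2 + constRV P (2 * r) * (y₁ * y₂)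
        + constRV P (2 * s) * (y₁ * y₃) + constRV P (2 * t) * (y₁ * y₄)
        + constRV P (2 * r * s) * (y₂ * y₃) + constRV P (2 * r * t) * (y₂ * y₄)
        + constRV P (2 * s * t) * (y₃ * y₄) by
        simp only [constRV, map_mul, map_pow, map_ofNat]; ring]
    simp only [map_add, expect_const_mul]
  -- The same polarization in degree four: eight sign choices times 4! give 192.
  have key : constRV P 192 * (y₁ * y₂ * y₃ * y₄) =
      (y₁ + constRV P 1 * y₂ + constRV P 1 * y₃ + constRV P 1 * y₄) ^ 4
      - (y₁ + constRV P 1 * y₂ + constRV P 1 * y₃ + constRV P (-1) * y₄) ^ 4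
      - (y₁ + constRV P 1 * y₂ + constRV P (-1) * y₃ + constRV P 1 * y₄) ^ 4
      + (y₁ + constRV P 1 * y₂ + constRV P (-1) * y₃ + constRV P (-1) * y₄) ^ 4
      - (y₁ + constRV P (-1) * y₂ + constRV P 1 * y₃ + constRV P 1 * y₄) ^ 4
      + (y₁ + constRV P (-1) * y₂ + constRV P 1 * y₃ + constRV P (-1) * y₄) ^ 4
      + (y₁ + constRV P (-1) * y₂ + constRV P (-1) * y₃ + constRV P 1 * y₄) ^ 4
      - (y₁ + constRV P (-1) * y₂ + constRV P (-1) * y₃ + constRV P (-1) * y₄) ^ 4 := by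
    simp only [constRV, map_neg, map_one, map_ofNat]
    ring
  have := congrArg (expect P) key
  simp only [map_add, map_sub, expect_const_mul, h] at this
  linear_combination this / 192

/-- Fourth mixed moment of Gaussian random variables with arbitrary means. -/
lemma expect_mul_four_add_const (hX : HasGaussianLaw X P) (h0 : ∫ ω, X ω ∂P = 0)
    {y₁ y₂ y₃ y₄ : momentAlgebra P} (h₁ : y₁ ∈ linearSpan P X) (h₂ : y₂ ∈ linearSpan P X)
    (h₃ : y₃ ∈ linearSpan P X) (h₄ : y₄ ∈ linearSpan P X) (a₁ a₂ a₃ a₄ : ℂ) :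
    expect P ((constRV P a₁ + y₁) * (constRV P a₂ + y₂)
        * ((constRV P a₃ + y₃) * (constRV P a₄ + y₄))) =
      (a₁ * a₂ + expect P (y₁ * y₂)) * (a₃ * a₄ + expect P (y₃ * y₄))
        + a₁ * a₃ * expect P (y₂ * y₄) + a₂ * a₄ * expect P (y₁ * y₃)
        + expect P (y₁ * y₃) * expect P (y₂ * y₄)
        + a₁ * a₄ * expect P (y₂ * y₃) + a₂ * a₃ * expect P (y₁ * y₄)
        + expect P (y₁ * y₄) * expect P (y₂ * y₃) := by
  -- After expansion only products of an even number of centred factors survive. They regroup as the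
  -- product of the means of the two pairs plus the terms that couple the pairs.
  have key : (constRV P a₁ + y₁) * (constRV P a₂ + y₂)
        * ((constRV P a₃ + y₃) * (constRV P a₄ + y₄)) =
      constRV P (a₁ * a₂ * a₃ * a₄)
      + constRV P (a₂ * a₃ * a₄) * y₁ + constRV P (a₁ * a₃ * a₄) * y₂
      + constRV P (a₁ * a₂ * a₄) * y₃ + constRV P (a₁ * a₂ * a₃) * y₄
      + constRV P (a₃ * a₄) * (y₁ * y₂) + constRV P (a₂ * a₄) * (y₁ * y₃)
      + constRV P (a₂ * a₃) * (y₁ * y₄) + constRV P (a₁ * a₄) * (y₂ * y₃)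
      + constRV P (a₁ * a₃) * (y₂ * y₄) + constRV P (a₁ * a₂) * (y₃ * y₄)
      + constRV P a₁ * (y₂ * y₃ * y₄) + constRV P a₂ * (y₁ * y₃ * y₄)
      + constRV P a₃ * (y₁ * y₂ * y₄) + constRV P a₄ * (y₁ * y₂ * y₃) + y₁ * y₂ * y₃ * y₄ := by
    simp only [constRV, map_mul]
    ring
  rw [key]
  simp only [map_add, expect_const_mul, expect_const, expect_linearSpan hX h0 h₁,
    expect_linearSpan hX h0 h₂, expect_linearSpan hX h0 h₃, expect_linearSpan hX h0 h₄,
    expect_mul_three_linearSpan hX h0 h₂ h₃ h₄, expect_mul_three_linearSpan hX h0 h₁ h₃ h₄,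
    expect_mul_three_linearSpan hX h0 h₁ h₂ h₄, expect_mul_three_linearSpan hX h0 h₁ h₂ h₃,
    expect_mul_four_linearSpan hX h0 h₁ h₂ h₃ h₄]
  ring

end GaussianMoments

end SCF

namespace SCF

/-! ### Independence of functions of disjoint families of sources. -/

section DependsOn

variable {Ω : Type*} [MeasurableSpace Ω] {P : Measure Ω} [IsProbabilityMeasure P]
  {ι : Type*} {E : ι → Type*} [∀ i, MeasurableSpace (E i)]

/-- The random variables that are measurable functions of the `X i` with `i ∈ S`. -/
def dependsOn (P : Measure Ω) [IsProbabilityMeasure P] (X : ∀ i, Ω → E i) (S : Finset ι) :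
    StarSubalgebra ℂ (momentAlgebra P) where
  carrier := {y | Measurable[MeasurableSpace.comap (fun ω (i : S) => X i ω) inferInstance]
    (y : Ω → ℂ)}
  mul_mem' ha hb := ha.mul hb
  add_mem' ha hb := ha.add hb
  algebraMap_mem' _ := measurable_const
  star_mem' ha := Complex.continuous_conj.measurable.comp ha

lemma mem_dependsOn {X : ∀ i, Ω → E i} {S : Finset ι} {i : ι} (hi : i ∈ S) {f : E i → ℂ}
    (hf : Measurable f) {y : momentAlgebra P} (hy : ∀ ω, (y : Ω → ℂ) ω = f (X i ω)) :
    y ∈ dependsOn P X S := by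
  have h : (y : Ω → ℂ) = (fun x : (j : S) → E j => f (x ⟨i, hi⟩)) ∘ fun ω (j : S) => X j ω :=
    funext hy
  have hg : Measurable fun x : (j : S) → E j => f (x ⟨i, hi⟩) :=
    hf.comp (measurable_pi_apply _)
  change Measurable[MeasurableSpace.comap (fun ω (i : S) => X i ω) inferInstance] (y : Ω → ℂ)
  rw [h]
  exact hg.comp (comap_measurable _)

/-- Disjoint subfamilies of an independent family generate independent σ-algebras, and y and z are
measurable with respect to these. -/
lemma expect_mul_of_dependsOn {X : ∀ i, Ω → E i} (hX : iIndepFun X P)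
    (hm : ∀ i, AEMeasurable (X i) P) {S T : Finset ι} (hST : Disjoint S T)
    {y z : momentAlgebra P} (hy : y ∈ dependsOn P X S) (hz : z ∈ dependsOn P X T) :
    expect P (y * z) = expect P y * expect P z := by
  have h := hX.indepFun_finset₀ S T hST hm
  rw [IndepFun_iff_Indep] at h
  have hyz : IndepFun (y : Ω → ℂ) (z : Ω → ℂ) P := by
    rw [IndepFun_iff_Indep]
    exact indep_of_indep_of_le_left (indep_of_indep_of_le_right h hz.comap_le) hy.comap_le
  exact hyz.integral_mul_eq_mul_integral (integrable_of_mem y).aestronglyMeasurable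
    (integrable_of_mem z).aestronglyMeasurable

/-- Second moments of linear combinations of uncorrelated random variables whose coefficients
are random and independent of these variables. -/
lemma expect_sum_mul_star_sum {X : ∀ i, Ω → E i} (hX : iIndepFun X P)
    (hm : ∀ i, AEMeasurable (X i) P) {S T : Finset ι} (hST : Disjoint S T)
    {κ : Type*} [Fintype κ] [DecidableEq κ] {t t' y : κ → momentAlgebra P} {v : κ → ℂ}
    (ht : ∀ m, t m ∈ dependsOn P X S) (ht' : ∀ m, t' m ∈ dependsOn P X S)
    (hy : ∀ m, y m ∈ dependsOn P X T)
    (hv : ∀ m n, expect P (y m * star (y n)) = if m = n then v m else 0) :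
    expect P ((∑ m, t m * y m) * star (∑ m, t' m * y m)) =
      ∑ m, v m * expect P (t m * star (t' m)) := by
  rw [star_sum, Finset.sum_mul_sum, map_sum]
  refine Finset.sum_congr rfl fun m _ => ?_
  -- Collecting both coefficients against both noises lets independence factor the expectation; the
  -- uncorrelated noises leave only the diagonal.
  have h : ∀ n, expect P (t m * y m * star (t' n * y n)) =
      if m = n then v m * expect P (t m * star (t' m)) else 0 := fun n => by
    rw [star_mul, show t m * y m * (star (y n) * star (t' n)) =
      (t m * star (t' n)) * (y m * star (y n)) by ring,
      expect_mul_of_dependsOn hX hm hST (mul_mem (ht m) (star_mem (ht' n)))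
        (mul_mem (hy m) (star_mem (hy n))), hv]
    split_ifs with hmn
    · subst hmn
      ring
    · ring
  simp only [map_sum, h, Finset.sum_ite_eq, Finset.mem_univ, if_true]

end DependsOn

lemma IsCN.pseudoCov_zero {Ω : Type*} [MeasurableSpace Ω] {P : Measure Ω} {n : ℕ}
    {X : Ω → Fin n → ℂ} {C : Matrix (Fin n) (Fin n) ℂ} (h : IsCN P X 0 C) (a b : Fin n) :
    ∫ ω, X ω a * X ω b ∂P = 0 := by
  simpa using h.pseudoCov a b

lemma IsCN.cov_zero {Ω : Type*} [MeasurableSpace Ω] {P : Measure Ω} {n : ℕ}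
    {X : Ω → Fin n → ℂ} {C : Matrix (Fin n) (Fin n) ℂ} (h : IsCN P X 0 C) (a b : Fin n) :
    ∫ ω, X ω a * conj (X ω b) ∂P = C a b := by
  simpa using h.cov a b

/-! ### The sources of randomness, split into pilot phase and data phase. -/

instance Source.instFinite {K L τ : ℕ} : Finite (Source K L τ) :=
  Finite.of_injective (β := (Fin K × Fin L) ⊕ (Fin L × Fin τ) ⊕ Fin K ⊕ Fin K ⊕ Fin L ⊕ Fin L)
    (fun
      | .chan i l => .inl (i, l)
      | .pilotNoise l t => .inr (.inl (l, t))
      | .sig i => .inr (.inr (.inl i))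
      | .dac i => .inr (.inr (.inr (.inl i)))
      | .recv l => .inr (.inr (.inr (.inr (.inl l))))
      | .adc l => .inr (.inr (.inr (.inr (.inr l)))))
    (by rintro ⟨⟩ ⟨⟩ h <;> simp_all)

instance Source.instFintype {K L τ : ℕ} : Fintype (Source K L τ) := Fintype.ofFinite _

/-- The sources of the data phase. -/
def Source.IsData {K L τ : ℕ} : Source K L τ → Prop
  | .chan _ _ => False
  | .pilotNoise _ _ => False
  | _ => True

open Classical in
/-- The sources of the data phase. -/
def dataSources (K L τ : ℕ) : Finset (Source K L τ) := Finset.univ.filter Source.IsData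

open Classical in
/-- The sources of the pilot phase. -/
def pilotSources (K L τ : ℕ) : Finset (Source K L τ) := Finset.univ.filter fun s => ¬ s.IsData

lemma mem_pilotSources {K L τ : ℕ} {s : Source K L τ} :
    s ∈ pilotSources K L τ ↔ ¬ s.IsData := by
  classical
  exact Finset.mem_filter.trans (and_iff_right (Finset.mem_univ _))

lemma mem_dataSources {K L τ : ℕ} {s : Source K L τ} : s ∈ dataSources K L τ ↔ s.IsData := by
  classical
  exact Finset.mem_filter.trans (and_iff_right (Finset.mem_univ _))

/-- The channels count as pilot sources, so channels and estimates lie on one side of this split,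
data symbols and data-phase noise on the other. -/
lemma disjoint_pilotSources_dataSources {K L τ : ℕ} :
    Disjoint (pilotSources K L τ) (dataSources K L τ) := by
  classical
  simp only [pilotSources, dataSources]
  exact (Finset.disjoint_filter_filter_not _ _ _).symm

/-! ### First and second moments of the sources under the model. -/

namespace Network.IsModel

variable {K L N τ : ℕ} {W : Network K L N τ} {Ω : Type*} [MeasurableSpace Ω]
  {P : Measure Ω} {X : Sources K L N τ Ω} (hX : W.IsModel P X)

include hX

lemma gaussian (s : Source K L τ) : HasGaussianLaw (X s) P := by
  cases s with
  | chan i l => exact (hX.chan i l).gaussian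
  | pilotNoise l t => exact (hX.pilotNoise l t).gaussian
  | sig i => exact (hX.sig i).gaussian
  | dac i => exact (hX.dac i).gaussian
  | recv l => exact (hX.recv l).gaussian
  | adc l => exact (hX.adc l).gaussian

/-- Isserlis' formula needs a single Gaussian vector containing both channels and pilot noise;
independence of the Gaussian sources provides it. -/
lemma gaussian_joint : HasGaussianLaw (fun ω s => X s ω) P :=
  hX.indep.hasGaussianLaw hX.gaussian

lemma gaussian_coord (s : Source K L τ) (a : Fin (s.dim N)) :
    HasGaussianLaw (fun ω => X s ω a) P :=
  (hX.gaussian s).map_fun (ContinuousLinearMap.proj (R := ℝ) (φ := fun _ => ℂ) a)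

lemma integral_coord (s : Source K L τ) (a : Fin (s.dim N)) : ∫ ω, X s ω a ∂P = 0 := by
  cases s with
  | chan i l => exact (hX.chan i l).mean a
  | pilotNoise l t => exact (hX.pilotNoise l t).mean a
  | sig i => exact (hX.sig i).mean a
  | dac i => exact (hX.dac i).mean a
  | recv l => exact (hX.recv l).mean a
  | adc l => exact (hX.adc l).mean a

lemma integral_joint : ∫ ω, (fun s => X s ω) ∂P = 0 := by
  ext s a
  let T : ((s : Source K L τ) → Fin (s.dim N) → ℂ) →L[ℝ] ℂ :=
    (ContinuousLinearMap.proj (R := ℝ) (φ := fun _ : Fin (s.dim N) => ℂ) a).comp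
      (ContinuousLinearMap.proj (R := ℝ) (φ := fun s : Source K L τ => Fin (s.dim N) → ℂ) s)
  have h := T.integral_comp_comm hX.gaussian_joint.integrable
  exact h.symm.trans (hX.integral_coord s a)

variable [IsProbabilityMeasure P]

/-- The coordinates of the sources. -/
def coord (s : Source K L τ) (a : Fin (s.dim N)) : momentAlgebra P :=
  ⟨fun ω => X s ω a, fun _ hp => (hX.gaussian_coord s a).memLp hp⟩

lemma coord_mem_linearSpan (s : Source K L τ) (a : Fin (s.dim N)) :
    hX.coord s a ∈ linearSpan P fun ω s => X s ω :=
  ⟨(ContinuousLinearMap.proj (R := ℝ) (φ := fun _ : Fin (s.dim N) => ℂ) a).comp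
    (ContinuousLinearMap.proj (R := ℝ) (φ := fun s : Source K L τ => Fin (s.dim N) → ℂ) s),
    fun _ => rfl⟩

lemma coord_mem_dependsOn {S : Finset (Source K L τ)} {s : Source K L τ} (hs : s ∈ S)
    (a : Fin (s.dim N)) : hX.coord s a ∈ dependsOn P X S :=
  mem_dependsOn hs (measurable_pi_apply a) fun _ => rfl

lemma expect_coord (s : Source K L τ) (a : Fin (s.dim N)) : expect P (hX.coord s a) = 0 :=
  hX.integral_coord s a

lemma expect_coord_mul_coord_self (s : Source K L τ) (a b : Fin (s.dim N)) :
    expect P (hX.coord s a * hX.coord s b) = 0 := by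
  change ∫ ω, X s ω a * X s ω b ∂P = 0
  cases s with
  | chan i l => exact (hX.chan i l).pseudoCov_zero a b
  | pilotNoise l t => exact (hX.pilotNoise l t).pseudoCov_zero a b
  | sig i => exact (hX.sig i).pseudoCov_zero a b
  | dac i => exact (hX.dac i).pseudoCov_zero a b
  | recv l => exact (hX.recv l).pseudoCov_zero a b
  | adc l => exact (hX.adc l).pseudoCov_zero a b

lemma expect_mul_of_dependsOn {S T : Finset (Source K L τ)} (hST : Disjoint S T)
    {y z : momentAlgebra P} (hy : y ∈ dependsOn P X S) (hz : z ∈ dependsOn P X T) :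
    expect P (y * z) = expect P y * expect P z :=
  SCF.expect_mul_of_dependsOn hX.indep (fun s => (hX.gaussian s).aemeasurable) hST hy hz

/-- Unconjugated products have mean zero: by circular symmetry within one source, by independence
and zero means across sources. This kills one of the three Isserlis pairings. -/
lemma expect_coord_mul_coord (s s' : Source K L τ) (a : Fin (s.dim N)) (b : Fin (s'.dim N)) :
    expect P (hX.coord s a * hX.coord s' b) = 0 := by
  by_cases h : s = s'
  · subst h
    exact hX.expect_coord_mul_coord_self s a b
  · rw [hX.expect_mul_of_dependsOn (Finset.disjoint_singleton.2 h)
      (hX.coord_mem_dependsOn (Finset.mem_singleton_self s) a)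
      (hX.coord_mem_dependsOn (Finset.mem_singleton_self s') b), hX.expect_coord, zero_mul]

lemma expect_coord_mul_star_coord_of_ne {s s' : Source K L τ} (h : s ≠ s') (a : Fin (s.dim N))
    (b : Fin (s'.dim N)) : expect P (hX.coord s a * star (hX.coord s' b)) = 0 := by
  rw [hX.expect_mul_of_dependsOn (Finset.disjoint_singleton.2 h)
    (hX.coord_mem_dependsOn (Finset.mem_singleton_self s) a)
    (star_mem (hX.coord_mem_dependsOn (Finset.mem_singleton_self s') b)), hX.expect_coord,
    zero_mul]

/-- Non-line-of-sight part of a channel. -/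
def chanRV (i : Fin K) (l : Fin L) (a : Fin N) : momentAlgebra P := hX.coord (.chan i l) a

/-- Noise during a pilot symbol. -/
def pilotRV (l : Fin L) (t : Fin τ) (a : Fin N) : momentAlgebra P := hX.coord (.pilotNoise l t) a

/-- Data symbol. -/
def sigRV (i : Fin K) : momentAlgebra P := hX.coord (.sig i) (0 : Fin 1)

/-- DAC noise. -/
def dacRV (i : Fin K) : momentAlgebra P := hX.coord (.dac i) (0 : Fin 1)

/-- Receiver noise. -/
def recvRV (l : Fin L) (a : Fin N) : momentAlgebra P := hX.coord (.recv l) a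

/-- ADC noise. -/
def adcRV (l : Fin L) (a : Fin N) : momentAlgebra P := hX.coord (.adc l) a

lemma expect_chanRV_mul_star (i j : Fin K) (l l' : Fin L) (a b : Fin N) :
    expect P (hX.chanRV i l a * star (hX.chanRV j l' b)) =
      if i = j ∧ l = l' then W.R i l a b else 0 := by
  split_ifs with h
  · obtain ⟨rfl, rfl⟩ := h
    exact (hX.chan i l).cov_zero a b
  · exact hX.expect_coord_mul_star_coord_of_ne (by simpa using h) _ _

lemma expect_pilotRV_mul_star (l l' : Fin L) (t t' : Fin τ) (a b : Fin N) :
    expect P (hX.pilotRV l t a * star (hX.pilotRV l' t' b)) =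
      if l = l' ∧ t = t' then W.Cn l a b else 0 := by
  split_ifs with h
  · obtain ⟨rfl, rfl⟩ := h
    exact (hX.pilotNoise l t).cov_zero a b
  · exact hX.expect_coord_mul_star_coord_of_ne (by simpa using h) _ _

lemma expect_pilotRV_mul_star_chanRV (l l' : Fin L) (t : Fin τ) (i : Fin K) (a b : Fin N) :
    expect P (hX.pilotRV l t a * star (hX.chanRV i l' b)) = 0 :=
  hX.expect_coord_mul_star_coord_of_ne (by simp) _ _

lemma expect_chanRV_mul_star_pilotRV (l l' : Fin L) (t : Fin τ) (i : Fin K) (a b : Fin N) :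
    expect P (hX.chanRV i l a * star (hX.pilotRV l' t b)) = 0 :=
  hX.expect_coord_mul_star_coord_of_ne (by simp) _ _

lemma expect_sigRV_mul_star (i j : Fin K) :
    expect P (hX.sigRV i * star (hX.sigRV j)) = if i = j then (W.p i : ℂ) else 0 := by
  split_ifs with h
  · subst h
    exact ((hX.sig i).cov_zero 0 0).trans (by simp)
  · exact hX.expect_coord_mul_star_coord_of_ne (by simpa using h) _ _

lemma expect_dacRV_mul_star (i j : Fin K) :
    expect P (hX.dacRV i * star (hX.dacRV j)) =
      if i = j then ((W.ρda * W.p i : ℝ) : ℂ) else 0 := by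
  split_ifs with h
  · subst h
    exact ((hX.dac i).cov_zero 0 0).trans (by simp)
  · exact hX.expect_coord_mul_star_coord_of_ne (by simpa using h) _ _

lemma expect_recvRV_mul_star (l l' : Fin L) (a b : Fin N) :
    expect P (hX.recvRV l a * star (hX.recvRV l' b)) =
      if l = l' ∧ a = b then (W.σsq : ℂ) else 0 := by
  by_cases h : l = l'
  · subst h
    exact ((hX.recv l).cov_zero a b).trans (by simp [Matrix.one_apply])
  · rw [if_neg (fun h' => h h'.1)]
    exact hX.expect_coord_mul_star_coord_of_ne (by simpa using h) _ _

lemma expect_adcRV_mul_star (l l' : Fin L) (a b : Fin N) :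
    expect P (hX.adcRV l a * star (hX.adcRV l' b)) =
      if l = l' then W.Cad P X l a b else 0 := by
  split_ifs with h
  · subst h
    exact (hX.adc l).cov_zero a b
  · exact hX.expect_coord_mul_star_coord_of_ne (by simpa using h) _ _

end Network.IsModel

end SCF

/-! ### Pilot correlation and the matrix Ψ. -/

namespace SCF
namespace Network

variable {K L N τ : ℕ} (W : Network K L N τ)

/-- The pilot sequences are orthogonal. -/
lemma sum_φ_mul_conj_φ (s t : Fin τ) :
    ∑ r, W.φ s r * conj (W.φ t r) = if s = t then (τ : ℂ) else 0 := by
  have hτ : (τ : ℂ) ≠ 0 := Nat.cast_ne_zero.2 (Fin.pos s).ne'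
  -- The summands are powers of a τ-th root of unity, so the sum is geometric. It vanishes unless ζ
  -- = 1, that is, unless τ divides t - s, which forces s = t since |t - s| < τ.
  set ζ : ℂ := Complex.exp (2 * Real.pi * Complex.I * (((t : ℕ) : ℂ) - ((s : ℕ) : ℂ)) / τ) with hζ
  have hterm : ∀ r : Fin τ, W.φ s r * conj (W.φ t r) = ζ ^ (r : ℕ) := fun r => by
    rw [hζ, ← Complex.exp_nat_mul, φ, φ, ← Complex.exp_conj, ← Complex.exp_add]
    congr 1
    simp only [map_div₀, map_mul, map_neg, Complex.conj_I, Complex.conj_ofReal, map_natCast,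
      Complex.conj_ofNat]
    field_simp
    ring
  rw [Finset.sum_congr rfl fun r _ => hterm r, Fin.sum_univ_eq_sum_range (fun r => ζ ^ r)]
  split_ifs with h
  · subst h
    simp [hζ]
  · have h1 : ζ ≠ 1 := fun h1 => by
      obtain ⟨n, hn⟩ := Complex.exp_eq_one_iff.1 h1
      have hn' : (((t : ℕ) : ℂ) - ((s : ℕ) : ℂ)) = n * τ := by
        field_simp at hn
        have := Complex.two_pi_I_ne_zero
        refine mul_left_cancel₀ this ?_
        linear_combination (2 * Real.pi * Complex.I) * hn
      have hn2 : ((t : ℕ) : ℤ) - ((s : ℕ) : ℤ) = n * τ := by exact_mod_cast hn'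
      have hs := s.2
      have ht := t.2
      have hn0 : n = 0 := by
        by_contra hne
        rcases lt_or_gt_of_ne hne with hlt | hgt
        · nlinarith
        · nlinarith
      subst hn0
      exact h (Fin.ext (by omega))
    have hpow : ζ ^ τ = 1 := by
      rw [hζ, ← Complex.exp_nat_mul, Complex.exp_eq_one_iff]
      exact ⟨((t : ℕ) : ℤ) - ((s : ℕ) : ℤ), by push_cast; field_simp⟩
    rw [geom_sum_eq h1, hpow, sub_self, zero_div]

/-- Weight of the noise in a pilot symbol in the correlated pilot signal. -/
def pilotWeight (k : Fin K) (t : Fin τ) : ℂ :=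
  ((1 / Real.sqrt τ : ℝ) : ℂ) * conj (W.φ (W.pilot k) t)

/-- The weights form a unit vector, so correlating with the pilot leaves the noise covariance `Cn`
unchanged. -/
lemma sum_pilotWeight (k : Fin K) :
    ∑ t, W.pilotWeight k t * conj (W.pilotWeight k t) = 1 := by
  have hτ : (0 : ℝ) < τ := Nat.cast_pos.2 (Fin.pos (W.pilot k))
  have h := W.sum_φ_mul_conj_φ (W.pilot k) (W.pilot k)
  rw [if_pos rfl] at h
  have hs : ((1 / Real.sqrt τ : ℝ) : ℂ) * ((1 / Real.sqrt τ : ℝ) : ℂ) * τ = 1 := by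
    norm_cast
    field_simp
    exact (Real.sq_sqrt hτ.le).symm
  rw [← hs, ← h, Finset.mul_sum]
  refine Finset.sum_congr rfl fun t _ => ?_
  simp only [pilotWeight, map_mul, Complex.conj_ofReal, Complex.conj_conj]
  ring

/-- The correlated pilot signal in terms of the channels and the noise. -/
lemma zw_apply {Ω : Type*} (X : Sources K L N τ Ω) (k : Fin K) (l : Fin L) (ω : Ω) (a : Fin N) :
    W.zw X k l ω a = ((1 - W.ρad : ℝ) : ℂ) *
        ∑ i ∈ W.PSet k, (Real.sqrt (W.pdd i * τ) : ℂ) * X (.chan i l) ω a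
      + ∑ t, W.pilotWeight k t * X (.pilotNoise l t) ω a := by
  have hτ : (0 : ℝ) < τ := Nat.cast_pos.2 (Fin.pos (W.pilot k))
  have hp : ∀ i, 0 ≤ W.pdd i := fun i =>
    mul_nonneg (sub_nonneg.2 W.ρda_lt_one.le) (W.p_nonneg i)
  have hs : ∀ i, ((1 / Real.sqrt τ : ℝ) : ℂ) * ((Real.sqrt (W.pdd i) : ℂ) * τ) =
      (Real.sqrt (W.pdd i * τ) : ℂ) := fun i => by
    rw [Real.sqrt_mul (hp i)]
    norm_cast
    have := Real.mul_self_sqrt hτ.le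
    field_simp
    rw [sq, this, mul_comm]
  -- Orthogonality of the pilots removes all UEs with another pilot and gives the remaining ones a
  -- factor τ.
  have hZ : (W.Z X l ω *ᵥ star (W.φ (W.pilot k))) a =
      ((1 - W.ρad : ℝ) : ℂ) * ∑ i ∈ W.PSet k,
          (Real.sqrt (W.pdd i) : ℂ) * τ * (W.hbar i l a + X (.chan i l) ω a)
        + ∑ t, conj (W.φ (W.pilot k) t) * X (.pilotNoise l t) ω a := by
    simp only [mulVec, dotProduct, Z, Matrix.add_apply, Matrix.smul_apply, Matrix.sum_apply,
      vecMulVec_apply, smul_eq_mul, Matrix.of_apply, Pi.star_apply, add_mul,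
      Finset.sum_add_distrib]
    congr 1
    · simp only [Finset.mul_sum, Finset.sum_mul]
      rw [Finset.sum_comm, PSet, Finset.sum_filter]
      refine Finset.sum_congr rfl fun i _ => ?_
      have := W.sum_φ_mul_conj_φ (W.pilot i) (W.pilot k)
      rw [show (∑ t, ((1 - W.ρad : ℝ) : ℂ) * ((Real.sqrt (W.pdd i) : ℂ) *
        (W.h X i l ω a * W.φ (W.pilot i) t)) * star (W.φ (W.pilot k) t)) =
        ((1 - W.ρad : ℝ) : ℂ) * (Real.sqrt (W.pdd i) : ℂ) * W.h X i l ω a *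
          ∑ t, W.φ (W.pilot i) t * conj (W.φ (W.pilot k) t) by
        rw [Finset.mul_sum]
        refine Finset.sum_congr rfl fun t _ => ?_
        simp only [RCLike.star_def]
        ring, this]
      split_ifs
      · rw [show W.h X i l ω a = W.hbar i l a + X (.chan i l) ω a from rfl]
        ring
      · simp
    · refine Finset.sum_congr rfl fun t _ => ?_
      simp only [RCLike.star_def]
      ring
  have hA : ∑ i ∈ W.PSet k, (Real.sqrt (W.pdd i * τ) : ℂ) * W.hbar i l a
      + ∑ i ∈ W.PSet k, (Real.sqrt (W.pdd i * τ) : ℂ) * X (.chan i l) ω a =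
      ((1 / Real.sqrt τ : ℝ) : ℂ) * ∑ i ∈ W.PSet k,
        (Real.sqrt (W.pdd i) : ℂ) * τ * (W.hbar i l a + X (.chan i l) ω a) := by
    rw [← Finset.sum_add_distrib, Finset.mul_sum]
    refine Finset.sum_congr rfl fun i _ => ?_
    rw [← hs]
    ring
  have hB : ∑ t, W.pilotWeight k t * X (.pilotNoise l t) ω a =
      ((1 / Real.sqrt τ : ℝ) : ℂ) *
        ∑ t, conj (W.φ (W.pilot k) t) * X (.pilotNoise l t) ω a := by
    rw [Finset.mul_sum]
    exact Finset.sum_congr rfl fun t _ => mul_assoc _ _ _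
  simp only [zw, z, Pi.sub_apply, Pi.smul_apply, smul_eq_mul, hZ, Finset.sum_apply]
  linear_combination -((1 - W.ρad : ℝ) : ℂ) * hA - hB

/-! Positivity of the matrices. -/

lemma pdd_nonneg (i : Fin K) : 0 ≤ W.pdd i :=
  mul_nonneg (sub_nonneg.2 W.ρda_lt_one.le) (W.p_nonneg i)

lemma one_sub_ρda_pos : 0 < 1 - W.ρda := sub_pos.2 W.ρda_lt_one

lemma one_sub_ρad_pos : 0 < 1 - W.ρad := sub_pos.2 W.ρad_lt_one

lemma S_posSemidef (l : Fin L) : (W.S l).PosSemidef := by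
  refine posSemidef_sum _ fun i _ => PosSemidef.smul ?_ (by exact_mod_cast W.pdd_nonneg i)
  exact (posSemidef_vecMulVec_self_star _).add (W.R_psd i l)

lemma posSemidef_diagonal_diag {n : Type*} [Fintype n] [DecidableEq n] {A : Matrix n n ℂ}
    (hA : A.PosSemidef) : (diagonal (diag A)).PosSemidef :=
  posSemidef_diagonal_iff.2 fun _ => hA.diag_nonneg

/-- The receiver noise contributes a positive multiple of the identity to two positive semidefinite
terms. This is what makes Ψ invertible. -/
lemma Cn_posDef (l : Fin L) : (W.Cn l).PosDef := by
  have h1 := W.one_sub_ρda_pos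
  have h2 := W.one_sub_ρad_pos
  have h3 := W.ρda_nonneg
  have h4 := W.ρad_nonneg
  have h5 := W.σsq_pos
  refine PosDef.posSemidef_add (((W.S_posSemidef l).smul ?_).add
    ((posSemidef_diagonal_diag (W.S_posSemidef l)).smul ?_)) (PosDef.one.smul ?_)
  · rw [Complex.zero_le_real]
    positivity
  · rw [Complex.zero_le_real]
    positivity
  · rw [Complex.zero_lt_real]
    positivity

lemma Psi_posDef (k : Fin K) (l : Fin L) : (W.Psi k l).PosDef := by
  refine PosDef.posSemidef_add (PosSemidef.smul (posSemidef_sum _ fun i _ =>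
    (W.R_psd i l).smul ?_) ?_) (W.Cn_posDef l)
  · rw [Complex.zero_le_real]
    exact mul_nonneg (W.pdd_nonneg i) (Nat.cast_nonneg _)
  · rw [Complex.zero_le_real]
    positivity

lemma isUnit_det_Psi (k : Fin K) (l : Fin L) : IsUnit (W.Psi k l).det :=
  (Matrix.isUnit_iff_isUnit_det _).1 (W.Psi_posDef k l).isUnit

end Network
end SCF

namespace SCF

/-! ### From the algebra back to functions on the sample space. -/

section Evaluation

variable {Ω : Type*} [MeasurableSpace Ω] {P : Measure Ω} [IsProbabilityMeasure P]

/-- Value of a random variable at a sample point. -/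
def evalRV (P : Measure Ω) [IsProbabilityMeasure P] (ω : Ω) : momentAlgebra P →ₐ[ℂ] ℂ where
  toFun y := y.1 ω
  map_one' := rfl
  map_mul' _ _ := rfl
  map_zero' := rfl
  map_add' _ _ := rfl
  commutes' _ := rfl

/-- Since `evalRV` is an algebra homomorphism, this translates the integrals of the statement into
`expect` and back. -/
lemma expect_eq_integral (y : momentAlgebra P) : expect P y = ∫ ω, evalRV P ω y ∂P := rfl

@[simp] lemma evalRV_star (ω : Ω) (y : momentAlgebra P) :
    evalRV P ω (star y) = conj (evalRV P ω y) := rfl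

@[simp] lemma evalRV_constRV (ω : Ω) (c : ℂ) : evalRV P ω (constRV P c) = c := rfl

lemma expect_sum_const_mul_mul {ι : Type*} (s : Finset ι) (c : ι → ℂ)
    (y : ι → momentAlgebra P) (z : momentAlgebra P) :
    expect P ((∑ i ∈ s, constRV P (c i) * y i) * z) = ∑ i ∈ s, c i * expect P (y i * z) := by
  simp only [Finset.sum_mul, map_sum, mul_assoc, expect_const_mul]

lemma expect_mul_star_sum_const_mul {ι : Type*} (s : Finset ι) (c : ι → ℂ)
    (y : ι → momentAlgebra P) (z : momentAlgebra P) :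
    expect P (z * star (∑ i ∈ s, constRV P (c i) * y i)) =
      ∑ i ∈ s, conj (c i) * expect P (z * star (y i)) := by
  simp only [star_sum, Finset.mul_sum, map_sum, star_mul, star_constRV]
  refine Finset.sum_congr rfl fun i _ => ?_
  rw [← expect_const_mul]
  congr 1
  ring

/-- Covariance matrix of linear images of random vectors. -/
lemma expect_mulVec_mul_star_mulVec {n : Type*} [Fintype n] (A B C : Matrix n n ℂ)
    (y z : n → momentAlgebra P) (h : ∀ a b, expect P (y a * star (z b)) = C a b) (a b : n) :
    expect P ((∑ a', constRV P (A a a') * y a') * star (∑ b', constRV P (B b b') * z b')) =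
      (A * C * Bᴴ) a b := by
  simp only [expect_sum_const_mul_mul, expect_mul_star_sum_const_mul, h]
  simp only [mul_apply, conjTranspose_apply, Finset.sum_mul, Finset.mul_sum, RCLike.star_def]
  refine Finset.sum_congr rfl fun i _ => Finset.sum_congr rfl fun j _ => ?_
  ring

end Evaluation

/-! ### Channel estimates and effective channels. -/

namespace Network.IsModel

variable {K L N τ : ℕ} {W : Network K L N τ} {Ω : Type*} [MeasurableSpace Ω]
  {P : Measure Ω} {X : Sources K L N τ Ω} (hX : W.IsModel P X) [IsProbabilityMeasure P]

lemma const_mem_dependsOn (S : Finset (Source K L τ)) (c : ℂ) :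
    constRV P c ∈ dependsOn P X S := (dependsOn P X S).algebraMap_mem c

include hX

/-- The correlated pilot signal. -/
def zwRV (k : Fin K) (l : Fin L) (a : Fin N) : momentAlgebra P :=
  constRV P ((1 - W.ρad : ℝ) : ℂ) *
      ∑ i ∈ W.PSet k, constRV P (Real.sqrt (W.pdd i * τ) : ℂ) * hX.chanRV i l a
    + ∑ t, constRV P (W.pilotWeight k t) * hX.pilotRV l t a

/-- The random part of the channel estimate. -/
def estRV (k : Fin K) (l : Fin L) (a : Fin N) : momentAlgebra P :=
  constRV P (((1 - W.ρad) * Real.sqrt (W.pdd k * τ) : ℝ) : ℂ) *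
    ∑ b, constRV P ((W.R k l * (W.Psi k l)⁻¹) a b) * hX.zwRV k l b

/-- The channel. -/
def hRV (i : Fin K) (l : Fin L) (a : Fin N) : momentAlgebra P :=
  constRV P (W.hbar i l a) + hX.chanRV i l a

/-- The channel estimate. -/
def hhatRV (k : Fin K) (l : Fin L) (a : Fin N) : momentAlgebra P :=
  constRV P (W.hbar k l a) + hX.estRV k l a

/-- The effective channel after maximum ratio combining. -/
def gRV (k i : Fin K) (l : Fin L) : momentAlgebra P :=
  ∑ a, star (hX.hhatRV k l a) * hX.hRV i l a

lemma evalRV_hRV (i : Fin K) (l : Fin L) (a : Fin N) (ω : Ω) :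
    evalRV P ω (hX.hRV i l a) = W.h X i l ω a := rfl

lemma evalRV_hhatRV (k : Fin K) (l : Fin L) (a : Fin N) (ω : Ω) :
    evalRV P ω (hX.hhatRV k l a) = W.hhat X k l ω a := by
  have hz : ∀ b, evalRV P ω (hX.zwRV k l b) = W.zw X k l ω b := fun b => by
    rw [zw_apply]
    simp only [zwRV, map_add, map_mul, map_sum, evalRV_constRV]
    rfl
  simp only [hhatRV, estRV, map_add, map_mul, map_sum, evalRV_constRV, hz]
  rfl

lemma evalRV_gRV (k i : Fin K) (l : W.M k) (ω : Ω) :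
    evalRV P ω (hX.gRV k i l) = W.g X (W.hhat X) k i ω l := by
  simp only [gRV, map_sum, map_mul, evalRV_star, evalRV_hhatRV, evalRV_hRV]
  rfl

lemma chanRV_mem_linearSpan (i : Fin K) (l : Fin L) (a : Fin N) :
    hX.chanRV i l a ∈ linearSpan P fun ω s => X s ω := hX.coord_mem_linearSpan _ _

lemma estRV_mem_linearSpan (k : Fin K) (l : Fin L) (a : Fin N) :
    hX.estRV k l a ∈ linearSpan P fun ω s => X s ω := by
  refine const_mul_mem_linearSpan _ (sum_mem fun b _ => const_mul_mem_linearSpan _ ?_)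
  exact add_mem (const_mul_mem_linearSpan _ (sum_mem fun i _ => const_mul_mem_linearSpan _
    (hX.coord_mem_linearSpan _ _))) (sum_mem fun t _ => const_mul_mem_linearSpan _
    (hX.coord_mem_linearSpan _ _))

lemma hRV_mem_dependsOn (i : Fin K) (l : Fin L) (a : Fin N) :
    hX.hRV i l a ∈ dependsOn P X (pilotSources K L τ) :=
  add_mem (const_mem_dependsOn _ _) (hX.coord_mem_dependsOn (mem_pilotSources.2 id) _)

lemma hhatRV_mem_dependsOn (k : Fin K) (l : Fin L) (a : Fin N) :
    hX.hhatRV k l a ∈ dependsOn P X (pilotSources K L τ) := by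
  refine add_mem (const_mem_dependsOn _ _) (mul_mem (const_mem_dependsOn _ _)
    (sum_mem fun b _ => mul_mem (const_mem_dependsOn _ _) (add_mem
      (mul_mem (const_mem_dependsOn _ _) (sum_mem fun i _ => mul_mem
        (const_mem_dependsOn _ _) (hX.coord_mem_dependsOn ?_ _)))
      (sum_mem fun t _ => mul_mem (const_mem_dependsOn _ _)
        (hX.coord_mem_dependsOn ?_ _)))))
  all_goals exact mem_pilotSources.2 id

lemma gRV_mem_dependsOn (k i : Fin K) (l : Fin L) :
    hX.gRV k i l ∈ dependsOn P X (pilotSources K L τ) :=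
  sum_mem fun _ _ => mul_mem (star_mem (hX.hhatRV_mem_dependsOn _ _ _))
    (hX.hRV_mem_dependsOn _ _ _)

/-! Second moments. -/

lemma expect_zwRV_mul_star_chanRV (k j : Fin K) (l l' : Fin L) (a b : Fin N) :
    expect P (hX.zwRV k l a * star (hX.chanRV j l' b)) =
      if l = l' ∧ j ∈ W.PSet k then
        ((1 - W.ρad : ℝ) : ℂ) * (Real.sqrt (W.pdd j * τ) : ℂ) * W.R j l a b else 0 := by
  simp only [zwRV, add_mul, map_add, mul_assoc, expect_const_mul, expect_sum_const_mul_mul,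
    expect_chanRV_mul_star, expect_pilotRV_mul_star_chanRV, mul_zero, Finset.sum_const_zero,
    add_zero]
  by_cases hl : l = l'
  · by_cases hj : j ∈ W.PSet k <;> simp [hl, hj]
  · simp [hl]

/-- This identifies Ψ as a covariance: the UEs on the same pilot contribute their R, the noise
contributes `Cn`, and different APs share no source. -/
lemma expect_zwRV_mul_star_zwRV (k : Fin K) (l l' : Fin L) (a b : Fin N) :
    expect P (hX.zwRV k l a * star (hX.zwRV k l' b)) =
      if l = l' then W.Psi k l a b else 0 := by
  have h1 : ∀ j ∈ W.PSet k, expect P (hX.zwRV k l a * star (hX.chanRV j l' b)) =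
      if l = l' then ((1 - W.ρad : ℝ) : ℂ) * (Real.sqrt (W.pdd j * τ) : ℂ) * W.R j l a b
        else 0 := fun j hj => by
    rw [expect_zwRV_mul_star_chanRV]
    simp [hj]
  have h2 : ∀ t, expect P (hX.zwRV k l a * star (hX.pilotRV l' t b)) =
      if l = l' then W.pilotWeight k t * W.Cn l a b else 0 := fun t => by
    simp only [zwRV, add_mul, map_add, mul_assoc, expect_const_mul, expect_sum_const_mul_mul,
      expect_chanRV_mul_star_pilotRV, expect_pilotRV_mul_star, mul_zero, Finset.sum_const_zero,
      zero_add]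
    by_cases hl : l = l' <;> simp [hl]
  have h3 : expect P (hX.zwRV k l a * star (hX.zwRV k l' b)) =
      ((1 - W.ρad : ℝ) : ℂ) * ∑ j ∈ W.PSet k, (Real.sqrt (W.pdd j * τ) : ℂ) *
          expect P (hX.zwRV k l a * star (hX.chanRV j l' b))
        + ∑ t, conj (W.pilotWeight k t) *
          expect P (hX.zwRV k l a * star (hX.pilotRV l' t b)) := by
    -- Only the conjugated factor is unfolded, so that the cross moments `h1` and `h2` apply.
    conv_lhs => rw [zwRV.eq_1 hX k l' b]
    rw [star_add, mul_add, map_add, expect_mul_star_sum_const_mul, star_mul, star_constRV,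
      ← mul_assoc, mul_comm _ (constRV P _), expect_const_mul, expect_mul_star_sum_const_mul]
    simp only [Complex.conj_ofReal]
  rw [h3, Finset.sum_congr rfl fun j hj => congrArg (_ * ·) (h1 j hj)]
  simp only [h2]
  split_ifs with hl
  · have hw : ∑ t, conj (W.pilotWeight k t) * (W.pilotWeight k t * W.Cn l a b) =
        W.Cn l a b := by
      have h := congrArg (· * W.Cn l a b) (W.sum_pilotWeight k)
      simp only [one_mul, Finset.sum_mul] at h
      exact (Finset.sum_congr rfl fun t _ => by ring).trans h
    rw [hw]
    simp only [Psi, Matrix.add_apply, Matrix.smul_apply, Matrix.sum_apply, smul_eq_mul,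
      Finset.mul_sum]
    congr 1
    refine Finset.sum_congr rfl fun j _ => ?_
    have hs : (Real.sqrt (W.pdd j * τ) : ℂ) * (Real.sqrt (W.pdd j * τ) : ℂ) =
        ((W.pdd j * τ : ℝ) : ℂ) := by
      rw [← Complex.ofReal_mul, Real.mul_self_sqrt
        (mul_nonneg (W.pdd_nonneg j) (Nat.cast_nonneg _))]
    rw [← hs]
    push_cast
    ring
  · simp

lemma expect_zwRV_mul_chanRV (k j : Fin K) (l l' : Fin L) (a b : Fin N) :
    expect P (hX.zwRV k l a * hX.chanRV j l' b) = 0 := by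
  have h1 : ∀ i, expect P (hX.chanRV i l a * hX.chanRV j l' b) = 0 := fun i =>
    hX.expect_coord_mul_coord _ _ _ _
  have h2 : ∀ t, expect P (hX.pilotRV l t a * hX.chanRV j l' b) = 0 := fun t =>
    hX.expect_coord_mul_coord _ _ _ _
  simp only [zwRV, add_mul, map_add, mul_assoc, expect_const_mul, expect_sum_const_mul_mul,
    h1, h2, mul_zero, Finset.sum_const_zero, add_zero]

lemma expect_estRV_mul_chanRV (k j : Fin K) (l l' : Fin L) (a b : Fin N) :
    expect P (hX.estRV k l a * hX.chanRV j l' b) = 0 := by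
  simp only [estRV, mul_assoc, expect_const_mul, expect_sum_const_mul_mul,
    expect_zwRV_mul_chanRV, mul_zero, Finset.sum_const_zero]

lemma expect_estRV_mul_star_chanRV (k j : Fin K) (l l' : Fin L) (a b : Fin N) :
    expect P (hX.estRV k l a * star (hX.chanRV j l' b)) =
      if l = l' ∧ j ∈ W.PSet k then
        (((1 - W.ρad) ^ 2 * τ * Real.sqrt (W.pdd k * W.pdd j) : ℝ) : ℂ) *
          (W.R k l * (W.Psi k l)⁻¹ * W.R j l) a b else 0 := by
  simp only [estRV, mul_assoc, expect_const_mul, expect_sum_const_mul_mul,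
    expect_zwRV_mul_star_chanRV]
  split_ifs
  · have hs : Real.sqrt (W.pdd k * τ) * Real.sqrt (W.pdd j * τ) =
        τ * Real.sqrt (W.pdd k * W.pdd j) := by
      rw [← Real.sqrt_mul (mul_nonneg (W.pdd_nonneg k) (Nat.cast_nonneg _)),
        show W.pdd k * τ * (W.pdd j * τ) = (τ : ℝ) ^ 2 * (W.pdd k * W.pdd j) by ring,
        Real.sqrt_mul (sq_nonneg _), Real.sqrt_sq (Nat.cast_nonneg _)]
    have hs' := congrArg (fun x : ℝ => (x : ℂ)) hs
    simp only [Complex.ofReal_mul] at hs'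
    rw [← mul_assoc (W.R k l), mul_apply, Finset.mul_sum, Finset.mul_sum]
    refine Finset.sum_congr rfl fun b' _ => ?_
    push_cast
    linear_combination ((1 - W.ρad : ℂ)) ^ 2 * (W.R k l * (W.Psi k l)⁻¹) a b' *
      W.R j l b' b * hs'
  · simp

/-- The covariance of RΨ⁻¹z is RΨ⁻¹ΨΨ⁻¹R, and the middle Ψ cancels. -/
lemma expect_estRV_mul_star_estRV (k : Fin K) (l l' : Fin L) (a b : Fin N) :
    expect P (hX.estRV k l a * star (hX.estRV k l' b)) =
      if l = l' then (((1 - W.ρad) ^ 2 * τ * W.pdd k : ℝ) : ℂ) *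
        (W.R k l * (W.Psi k l)⁻¹ * W.R k l) a b else 0 := by
  have hs : Real.sqrt (W.pdd k * τ) * Real.sqrt (W.pdd k * τ) = W.pdd k * τ :=
    Real.mul_self_sqrt (mul_nonneg (W.pdd_nonneg k) (Nat.cast_nonneg _))
  have hc : (1 - W.ρad) * Real.sqrt (W.pdd k * τ) * ((1 - W.ρad) * Real.sqrt (W.pdd k * τ)) =
      (1 - W.ρad) ^ 2 * τ * W.pdd k := by linear_combination (1 - W.ρad) ^ 2 * hs
  have hfac : ∀ y z : momentAlgebra P, ∀ c : ℝ,
      expect P (constRV P (c : ℂ) * y * star (constRV P (c : ℂ) * z)) =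
        ((c * c : ℝ) : ℂ) * expect P (y * star z) := fun y z c => by
    rw [star_mul, star_constRV, Complex.conj_ofReal, ← expect_const_mul]
    congr 1
    simp only [constRV, Complex.ofReal_mul, map_mul]
    ring
  rw [estRV, estRV, hfac, hc]
  split_ifs with hl
  · subst hl
    rw [expect_mulVec_mul_star_mulVec _ _ (W.Psi k l) _ _ fun a b => by
      rw [expect_zwRV_mul_star_zwRV, if_pos rfl]]
    rw [conjTranspose_mul, (W.R_psd k l).isHermitian.eq,
      (W.Psi_posDef k l).isHermitian.inv.eq, mul_assoc (W.R k l),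
      nonsing_inv_mul _ (W.isUnit_det_Psi k l), mul_one, mul_assoc (W.R k l)]
  · simp only [expect_sum_const_mul_mul]
    simp only [expect_mul_star_sum_const_mul, expect_zwRV_mul_star_zwRV, hl, if_false, mul_zero,
      Finset.sum_const_zero]

/-! Moments of the effective channels. -/

/-- This is pilot contamination: the estimate for UE k is correlated with the channel of UE i
exactly when that channel enters the pilot signal of k. -/
lemma expect_star_estRV_mul_chanRV (k i : Fin K) (l : Fin L) :
    ∑ a, expect P (star (hX.estRV k l a) * hX.chanRV i l a) =
      if i ∈ W.PSet k then W.b k i l else 0 := by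
  have h : ∀ a, expect P (star (hX.estRV k l a) * hX.chanRV i l a) =
      conj (expect P (hX.estRV k l a * star (hX.chanRV i l a))) := fun a => by
    rw [← expect_star, star_mul, star_star, mul_comm]
  simp only [h, expect_estRV_mul_star_chanRV, true_and]
  split_ifs
  · rw [b, ← map_sum, ← Finset.mul_sum, map_mul, Complex.conj_ofReal]
    congr 1
    -- Conjugation reverses the three Hermitian factors, turning tr(R_k Ψ⁻¹ R_i) into the order used
    -- in `b`.
    change star (trace _) = _
    rw [← trace_conjTranspose, conjTranspose_mul, conjTranspose_mul,
      (W.R_psd k l).isHermitian.eq, (W.R_psd i l).isHermitian.eq,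
      (W.Psi_posDef k l).isHermitian.inv.eq, mul_assoc]
  · simp

lemma expect_gRV (k i : Fin K) (l : Fin L) :
    expect P (hX.gRV k i l) = W.lam k i l + if i ∈ W.PSet k then W.b k i l else 0 := by
  rw [← hX.expect_star_estRV_mul_chanRV, lam, dotProduct, ← Finset.sum_add_distrib, gRV, map_sum]
  refine Finset.sum_congr rfl fun a _ => ?_
  have hg := hX.gaussian_joint
  have h0 := hX.integral_joint
  rw [hhatRV, hRV, star_add, star_constRV, add_mul, mul_add, mul_add, map_add, map_add, map_add,
    mul_comm (star (hX.estRV k l a)) (constRV P _), expect_const_mul, expect_const_mul,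
    expect_const_mul, expect_const, expect_linearSpan hg h0 (hX.chanRV_mem_linearSpan i l a),
    expect_linearSpan hg h0 (star_mem_linearSpan (hX.estRV_mem_linearSpan k l a))]
  simp

/-- Expanded over antennas, each term is a fourth moment of Gaussians with means. The covariance
left after removing the means couples sources of the same AP only, hence it is diagonal. -/
lemma expect_gRV_mul_star_gRV (k i : Fin K) (l l' : Fin L) :
    expect P (hX.gRV k i l * star (hX.gRV k i l')) =
      expect P (hX.gRV k i l) * conj (expect P (hX.gRV k i l'))
        + if l = l' then W.c k i l else 0 := by
  have hg := hX.gaussian_joint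
  have h0 := hX.integral_joint
  have hm : ∀ l, expect P (hX.gRV k i l) = ∑ a, (conj (W.hbar k l a) * W.hbar i l a
      + expect P (star (hX.estRV k l a) * hX.chanRV i l a)) := fun l => by
    rw [expect_gRV, Finset.sum_add_distrib, expect_star_estRV_mul_chanRV]
    rfl
  have key : ∀ a b, expect P (star (hX.hhatRV k l a) * hX.hRV i l a *
        star (star (hX.hhatRV k l' b) * hX.hRV i l' b)) =
      (conj (W.hbar k l a) * W.hbar i l a
          + expect P (star (hX.estRV k l a) * hX.chanRV i l a)) *
        conj (conj (W.hbar k l' b) * W.hbar i l' b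
          + expect P (star (hX.estRV k l' b) * hX.chanRV i l' b))
      + if l = l' then conj (W.hbar k l a) * (W.R i l a b * W.hbar k l b)
          + (((1 - W.ρad) ^ 2 * τ * W.pdd k : ℝ) : ℂ) * (conj (W.hbar i l b) *
            ((W.R k l * (W.Psi k l)⁻¹ * W.R k l) b a * W.hbar i l a))
          + (((1 - W.ρad) ^ 2 * τ * W.pdd k : ℝ) : ℂ) *
            (W.R i l a b * (W.R k l * (W.Psi k l)⁻¹ * W.R k l) b a) else 0 := fun a b => by
    -- Among the pairings, (12)(34) belongs to the product of means. Pairs 13 and 24 need l = l' and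
    -- give the three terms of `c`, while 14 and 23 vanish by circular symmetry.
    have e13 : expect P (star (hX.estRV k l a) * hX.estRV k l' b) = if l' = l then
        (((1 - W.ρad) ^ 2 * τ * W.pdd k : ℝ) : ℂ) *
          (W.R k l' * (W.Psi k l')⁻¹ * W.R k l') b a else 0 := by
      rw [mul_comm, expect_estRV_mul_star_estRV]
    have e14 : expect P (star (hX.estRV k l a) * star (hX.chanRV i l' b)) = 0 := by
      rw [mul_comm, ← star_mul, expect_star, expect_estRV_mul_chanRV, map_zero]
    have e23 : expect P (hX.chanRV i l a * hX.estRV k l' b) = 0 := by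
      rw [mul_comm, expect_estRV_mul_chanRV]
    have e24 : expect P (hX.chanRV i l a * star (hX.chanRV i l' b)) =
        if l = l' then W.R i l a b else 0 := by
      rw [expect_chanRV_mul_star]
      simp
    have e34 : expect P (hX.estRV k l' b * star (hX.chanRV i l' b)) =
        conj (expect P (star (hX.estRV k l' b) * hX.chanRV i l' b)) := by
      rw [← expect_star, star_mul, star_star, mul_comm]
    have h4 := expect_mul_four_add_const hg h0
      (star_mem_linearSpan (hX.estRV_mem_linearSpan k l a)) (hX.chanRV_mem_linearSpan i l a)
      (hX.estRV_mem_linearSpan k l' b) (star_mem_linearSpan (hX.chanRV_mem_linearSpan i l' b))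
      (conj (W.hbar k l a)) (W.hbar i l a) (W.hbar k l' b) (conj (W.hbar i l' b))
    rw [e13, e14, e23, e24, e34] at h4
    rw [star_mul, star_star, mul_comm (star (hX.hRV i l' b)), hhatRV, hhatRV, hRV, hRV, star_add,
      star_add, star_constRV, star_constRV, h4]
    by_cases hl : l = l'
    · subst hl
      simp only [if_true, map_add, map_mul, Complex.conj_conj]
      ring
    · simp only [if_neg hl, if_neg (Ne.symm hl), map_add, map_mul, Complex.conj_conj]
      ring
  rw [hm, hm, map_sum, Finset.sum_mul_sum, gRV, gRV, star_sum, Finset.sum_mul_sum, map_sum]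
  simp only [map_sum, key, Finset.sum_add_distrib]
  congr 1
  split_ifs with hl
  · simp only [Finset.sum_add_distrib, c, trace, diag, dotProduct, mulVec, Finset.mul_sum,
      Pi.star_apply, RCLike.star_def, mul_assoc (W.R i l), mul_assoc (W.R k l),
      mul_apply (M := W.R i l)]
    rw [Finset.sum_comm (f := fun a b => (((1 - W.ρad) ^ 2 * τ * W.pdd k : ℝ) : ℂ) *
      (conj (W.hbar i l b) * ((W.R k l * ((W.Psi k l)⁻¹ * W.R k l)) b a * W.hbar i l a)))]
    ring
  · simp

end Network.IsModel

end SCF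

/-! ### Closed forms and positive definiteness. -/

namespace SCF
namespace Network

section ClosedForms

variable {K L N τ : ℕ} (W : Network K L N τ)

/-- All entries of the array response have the same modulus, so the diagonal part of h̄h̄ᴴ is a
multiple of the identity. That is why the line of sight enters one factor of d as a scalar. -/
lemma hbar_mul_conj (i : Fin K) (l : Fin L) (a : Fin N) :
    W.hbar i l a * conj (W.hbar i l a) = (W.βLOS i l : ℂ) := by
  have h0 : 0 ≤ W.βLOS i l :=
    div_nonneg (mul_nonneg (W.κ_nonneg i l) (W.β_nonneg i l)) (by linarith [W.κ_nonneg i l])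
  have he : ‖Complex.exp (-Complex.I * ((a : ℕ) : ℂ) * (Real.pi : ℂ) *
      (Real.sin (W.θ i l) : ℂ))‖ = 1 := by
    rw [show -Complex.I * ((a : ℕ) : ℂ) * (Real.pi : ℂ) * (Real.sin (W.θ i l) : ℂ) =
      ((-((a : ℕ) : ℝ) * Real.pi * Real.sin (W.θ i l) : ℝ) : ℂ) * Complex.I by push_cast; ring]
    exact Complex.norm_exp_ofReal_mul_I _
  rw [Complex.mul_conj', hbar, norm_mul, he, mul_one, Complex.norm_real,
    Real.norm_of_nonneg (Real.sqrt_nonneg _)]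
  norm_cast
  exact Real.sq_sqrt h0

/-- Second moment of an entry of a channel estimate. -/
def estPow (k : Fin K) (l : Fin L) (a : Fin N) : ℂ :=
  conj (W.hbar k l a) * W.hbar k l a + (((1 - W.ρad) ^ 2 * τ * W.pdd k : ℝ) : ℂ) *
    (W.R k l * (W.Psi k l)⁻¹ * W.R k l) a a

/-- Diagonal entries of the covariance matrix of the ADC noise. -/
def adcVar (l : Fin L) (a : Fin N) : ℂ :=
  ((W.ρad * (1 - W.ρad) : ℝ) : ℂ) *
    (∑ i, (W.p i : ℂ) * ((W.βLOS i l : ℂ) + W.R i l a a) + (W.σsq : ℂ))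

/-- This is d as noise power per antenna times power of the estimate. The receiver noise splits by
(1-ρ_ad)σ² = (1-ρ_ad)²σ² + ρ_ad(1-ρ_ad)σ², the second part being ADC noise; division by 1-ρ_da turns
p̈ into p. -/
lemma d_eq_sum (k : Fin K) (l : Fin L) :
    W.d k l = ∑ a, (((1 - W.ρad) ^ 2 * W.σsq : ℝ) + W.adcVar l a) * W.estPow k l a := by
  have h1 : (1 - (W.ρda : ℂ)) ≠ 0 := by exact_mod_cast W.one_sub_ρda_pos.ne'
  obtain ⟨B, hBr⟩ : ∃ B : ℝ, B = ∑ i, W.pdd i * W.β i l * W.κ i l / (W.κ i l + 1) := ⟨_, rfl⟩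
  have hB : (B : ℂ) = (1 - (W.ρda : ℂ)) * ∑ i, (W.p i : ℂ) * (W.βLOS i l : ℂ) := by
    rw [Finset.mul_sum, hBr]
    push_cast [pdd, βLOS]
    refine Finset.sum_congr rfl fun i _ => ?_
    ring
  have hD : ∀ a, (∑ i, (W.pdd i : ℂ) • W.R i l) a a =
      (1 - (W.ρda : ℂ)) * ∑ i, (W.p i : ℂ) * W.R i l a a := fun a => by
    simp only [Matrix.sum_apply, Matrix.smul_apply, smul_eq_mul, Finset.mul_sum, pdd]
    push_cast
    exact Finset.sum_congr rfl fun i _ => by ring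
  have hw : ∀ a, W.adcVar l a = ((W.ρad * (1 - W.ρad) : ℝ) : ℂ) *
      (∑ i, (W.p i : ℂ) * (W.βLOS i l : ℂ) + ∑ i, (W.p i : ℂ) * W.R i l a a + (W.σsq : ℂ)) :=
    fun a => by
      simp only [adcVar, mul_add, Finset.sum_add_distrib]
  simp only [d, ← hBr]
  simp only [mulVec_diagonal, dotProduct, trace, diag_apply, diagonal_mul, hD, mul_assoc,
    Pi.star_apply, RCLike.star_def]
  simp only [← mul_assoc (W.R k l)]
  push_cast
  rw [hB]
  simp only [hw, estPow, Finset.mul_sum (s := (Finset.univ : Finset (Fin N))),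
    ← Finset.sum_add_distrib (s := (Finset.univ : Finset (Fin N)))]
  refine Finset.sum_congr rfl fun a _ => ?_
  push_cast
  field_simp
  ring

lemma mul_inv_Psi_mul_posSemidef (k : Fin K) (l : Fin L) :
    (W.R k l * (W.Psi k l)⁻¹ * W.R k l).PosSemidef := by
  have h := (W.Psi_posDef k l).inv.posSemidef.conjTranspose_mul_mul_same (W.R k l)
  rwa [(W.R_psd k l).isHermitian.eq] at h

lemma estPow_nonneg (k : Fin K) (l : Fin L) (a : Fin N) : 0 ≤ W.estPow k l a := by
  refine add_nonneg ?_ (mul_nonneg ?_ (W.mul_inv_Psi_mul_posSemidef k l).diag_nonneg)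
  · rw [mul_comm, Complex.mul_conj]
    exact_mod_cast Complex.normSq_nonneg _
  · rw [Complex.zero_le_real]
    exact mul_nonneg (by positivity) (W.pdd_nonneg k)

lemma lam_add_b (k : Fin K) (l : Fin L) : W.lam k k l + W.b k k l = ∑ a, W.estPow k l a := by
  simp only [lam, b, estPow, Finset.sum_add_distrib, ← Finset.mul_sum,
    Real.sqrt_mul_self (W.pdd_nonneg k)]
  rfl

/-- The sum is the mean power of the estimate. If it vanished, h̄ would be zero and RΨ⁻¹R, being
positive semidefinite of trace zero, would be zero too; definiteness of Ψ⁻¹ then forces R = 0. -/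
lemma lam_add_b_pos {k : Fin K} {l : Fin L} (hp : 0 < W.p k)
    (h : W.hbar k l ≠ 0 ∨ W.R k l ≠ 0) : 0 < W.lam k k l + W.b k k l := by
  have hτ : (0 : ℝ) < τ := Nat.cast_pos.2 (Fin.pos (W.pilot k))
  have hκ : 0 < (((1 - W.ρad) ^ 2 * τ * W.pdd k : ℝ) : ℂ) := by
    have h1 := W.one_sub_ρda_pos
    have h2 := W.one_sub_ρad_pos
    rw [Complex.zero_lt_real, pdd]
    positivity
  have hpsd := W.mul_inv_Psi_mul_posSemidef k l
  rw [lam_add_b]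
  refine (Finset.sum_nonneg fun a _ => W.estPow_nonneg k l a).lt_of_ne' fun h0 => ?_
  have hz := (Finset.sum_eq_zero_iff_of_nonneg fun a _ => W.estPow_nonneg k l a).1 h0
  have hparts : ∀ a, conj (W.hbar k l a) * W.hbar k l a = 0 ∧
      (W.R k l * (W.Psi k l)⁻¹ * W.R k l) a a = 0 := fun a => by
    have hsum := hz a (Finset.mem_univ a)
    have hn : 0 ≤ conj (W.hbar k l a) * W.hbar k l a := by
      rw [mul_comm, Complex.mul_conj]
      exact_mod_cast Complex.normSq_nonneg _
    obtain ⟨h1, h2⟩ := (add_eq_zero_iff_of_nonneg hn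
      (mul_nonneg hκ.le hpsd.diag_nonneg)).1 hsum
    exact ⟨h1, (mul_eq_zero.1 h2).resolve_left hκ.ne'⟩
  rcases h with h | h
  · refine h (funext fun a => ?_)
    rcases mul_eq_zero.1 (hparts a).1 with h' | h'
    · simpa using h'
    · exact h'
  · refine h ?_
    have htr : trace (W.R k l * (W.Psi k l)⁻¹ * W.R k l) = 0 :=
      Finset.sum_eq_zero fun a _ => (hparts a).2
    have hmat := hpsd.trace_eq_zero_iff.1 htr
    have hinj : ∀ v, W.R k l *ᵥ v = 0 := fun v => by
      by_contra hv
      have hpos := (W.Psi_posDef k l).inv.dotProduct_mulVec_pos hv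
      have : star (W.R k l *ᵥ v) ⬝ᵥ ((W.Psi k l)⁻¹ *ᵥ (W.R k l *ᵥ v)) =
          star v ⬝ᵥ ((W.R k l * (W.Psi k l)⁻¹ * W.R k l) *ᵥ v) := by
        rw [star_mulVec, (W.R_psd k l).isHermitian.eq, ← dotProduct_mulVec, mulVec_mulVec,
          mulVec_mulVec, mul_assoc]
      rw [this, hmat, zero_mulVec, dotProduct_zero] at hpos
      exact lt_irrefl _ hpos
    exact Matrix.ext_of_mulVec_single fun a => by rw [hinj, zero_mulVec]

lemma adcVar_nonneg (l : Fin L) (a : Fin N) : 0 ≤ W.adcVar l a := by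
  refine mul_nonneg ?_ (add_nonneg (Finset.sum_nonneg fun i _ => mul_nonneg ?_
    (add_nonneg ?_ (W.R_psd i l).diag_nonneg)) ?_)
  · rw [Complex.zero_le_real]
    exact mul_nonneg W.ρad_nonneg W.one_sub_ρad_pos.le
  · exact_mod_cast W.p_nonneg i
  · rw [Complex.zero_le_real]
    exact div_nonneg (mul_nonneg (W.κ_nonneg i l) (W.β_nonneg i l))
      (by linarith [W.κ_nonneg i l])
  · exact_mod_cast W.σsq_pos.le

/-- The receiver noise alone contributes (1-ρ_ad)²σ²(λ + b), which is positive, and the ADC part is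
nonnegative. -/
lemma d_pos {k : Fin K} {l : Fin L} (hp : 0 < W.p k)
    (h : W.hbar k l ≠ 0 ∨ W.R k l ≠ 0) : 0 < W.d k l := by
  have hw : 0 < (((1 - W.ρad) ^ 2 * W.σsq : ℝ) : ℂ) := by
    have h1 := W.σsq_pos
    have h2 := W.one_sub_ρad_pos
    rw [Complex.zero_lt_real]
    positivity
  rw [d_eq_sum]
  simp only [add_mul, Finset.sum_add_distrib, ← Finset.mul_sum, ← lam_add_b]
  exact add_pos_of_pos_of_nonneg (mul_pos hw (W.lam_add_b_pos hp h))
    (Finset.sum_nonneg fun a _ => mul_nonneg (W.adcVar_nonneg l a) (W.estPow_nonneg k l a))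

open scoped MatrixOrder in
-- Writing B = SᴴS, cyclicity gives tr(AB) = tr(SASᴴ).
lemma trace_mul_nonneg {n : Type*} [Fintype n] {A B : Matrix n n ℂ} (hA : A.PosSemidef)
    (hB : B.PosSemidef) : 0 ≤ trace (A * B) := by
  classical
  obtain ⟨S, rfl⟩ := CStarAlgebra.nonneg_iff_eq_star_mul_self.mp hB.nonneg
  rw [star_eq_conjTranspose, ← mul_assoc, trace_mul_comm, ← mul_assoc]
  exact (hA.mul_mul_conjTranspose_same S).trace_nonneg

lemma c_nonneg (k i : Fin K) (l : Fin L) : 0 ≤ W.c k i l := by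
  have hκ : 0 ≤ (((1 - W.ρad) ^ 2 * τ * W.pdd k : ℝ) : ℂ) := by
    rw [Complex.zero_le_real]
    exact mul_nonneg (by positivity) (W.pdd_nonneg k)
  have hpsd := W.mul_inv_Psi_mul_posSemidef k l
  refine add_nonneg (add_nonneg (mul_nonneg hκ ?_) ((W.R_psd i l).dotProduct_mulVec_nonneg _))
    (mul_nonneg hκ (hpsd.dotProduct_mulVec_nonneg _))
  rw [mul_assoc (W.R i l), mul_assoc (W.R i l)]
  exact trace_mul_nonneg (W.R_psd i l) hpsd

/-- Mean of the effective channel in closed form. -/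
def gMean (k i : Fin K) : W.M k → ℂ :=
  W.lamV k i + if i ∈ W.PSet k then W.bV k i else 0

/-- Second moment of the effective channel in closed form. -/
def gOuter (k i : Fin K) : Matrix (W.M k) (W.M k) ℂ :=
  vecMulVec (W.gMean k i) (star (W.gMean k i)) + diagonal fun l : W.M k => W.c k i l

lemma mem_PSet_self (k : Fin K) : k ∈ W.PSet k := by simp [PSet]

lemma gMean_self (k : Fin K) : W.gMean k k = W.lamV k k + W.bV k k := by
  rw [gMean, if_pos (W.mem_PSet_self k)]

/-- For pilot-sharing UEs the terms in b complete λλᴴ to (λ + b)(λ + b)ᴴ, the outer product of the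
mean of g. -/
lemma CMat_eq (k : Fin K) (Q : Finset (Fin K)) :
    W.CMat k Q = (((1 - W.ρad) ^ 2 / (1 - W.ρda) : ℝ) : ℂ) •
        ∑ i ∈ Q, (W.pdd i : ℂ) • W.gOuter k i
      - (((1 - W.ρad) ^ 2 * W.pdd k : ℝ) : ℂ) •
        vecMulVec (W.gMean k k) (star (W.gMean k k))
      + diagonal fun l : W.M k => W.d k l := by
  have h : ∑ i ∈ Q, (W.pdd i : ℂ) •
          (vecMulVec (W.lamV k i) (star (W.lamV k i)) + diagonal fun l : W.M k => W.c k i l)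
        + ∑ i ∈ W.PSet k ∩ Q, (W.pdd i : ℂ) •
          (vecMulVec (W.bV k i) (star (W.bV k i)) + vecMulVec (W.bV k i) (star (W.lamV k i))
            + vecMulVec (W.lamV k i) (star (W.bV k i))) =
      ∑ i ∈ Q, (W.pdd i : ℂ) • W.gOuter k i := by
    rw [Finset.inter_comm, ← Finset.filter_mem_eq_inter, Finset.sum_filter,
      ← Finset.sum_add_distrib]
    refine Finset.sum_congr rfl fun i _ => ?_
    rw [gOuter, gMean]
    split_ifs
    · rw [← smul_add]
      congr 1
      rw [star_add, add_vecMulVec, vecMulVec_add, vecMulVec_add]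
      abel
    · simp
  rw [CMat, gMean_self, h]

lemma gOuter_posSemidef (k i : Fin K) : (W.gOuter k i).PosSemidef :=
  (posSemidef_vecMulVec_self_star _).add (posSemidef_diagonal_iff.2 fun _ => W.c_nonneg k i _)

/-- The subtracted matrix is absorbed by the term i = k, since 1/(1-ρ_da) - 1 = ρ_da/(1-ρ_da) ≥ 0.
Everything left is positive semidefinite except Λ(d), which is positive definite. -/
lemma CMat_posDef {k : Fin K} (hp : 0 < W.p k)
    (h : ∀ l ∈ W.M k, W.hbar k l ≠ 0 ∨ W.R k l ≠ 0) {Q : Finset (Fin K)} (hk : k ∈ Q) :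
    (W.CMat k Q).PosDef := by
  have h1 := W.one_sub_ρda_pos
  have h2 := W.one_sub_ρad_pos
  have hpk := W.pdd_nonneg k
  have hA : 0 ≤ (((1 - W.ρad) ^ 2 / (1 - W.ρda) : ℝ) : ℂ) := by
    rw [Complex.zero_le_real]
    positivity
  have hpi : ∀ i, 0 ≤ (W.pdd i : ℂ) := fun i => by exact_mod_cast W.pdd_nonneg i
  have hsplit : W.CMat k Q = ((((1 - W.ρad) ^ 2 / (1 - W.ρda) : ℝ) : ℂ) •
        (∑ i ∈ Q.erase k, (W.pdd i : ℂ) • W.gOuter k i + (W.pdd k : ℂ) •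
          diagonal fun l : W.M k => W.c k k l)
      + (((1 - W.ρad) ^ 2 * W.pdd k * (W.ρda / (1 - W.ρda)) : ℝ) : ℂ) •
        vecMulVec (W.gMean k k) (star (W.gMean k k)))
      + diagonal fun l : W.M k => W.d k l := by
    rw [CMat_eq, ← Finset.sum_erase_add _ _ hk]
    congr 1
    have hc : (((1 - W.ρad) ^ 2 * W.pdd k * (W.ρda / (1 - W.ρda)) : ℝ) : ℂ) =
        (((1 - W.ρad) ^ 2 / (1 - W.ρda) : ℝ) : ℂ) * (W.pdd k : ℂ)
          - (((1 - W.ρad) ^ 2 * W.pdd k : ℝ) : ℂ) := by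
      rw [← Complex.ofReal_mul, ← Complex.ofReal_sub]
      congr 1
      field_simp
      ring
    rw [hc, show W.gOuter k k = vecMulVec (W.gMean k k) (star (W.gMean k k))
      + diagonal fun l : W.M k => W.c k k l from rfl]
    module
  rw [hsplit]
  refine PosDef.posSemidef_add (((PosSemidef.add (posSemidef_sum _ fun i _ =>
    (W.gOuter_posSemidef k i).smul (hpi i)) ((posSemidef_diagonal_iff.2 fun _ =>
      W.c_nonneg k k _).smul (hpi k))).smul hA).add
      ((posSemidef_vecMulVec_self_star _).smul ?_)) (posDef_diagonal_iff.2 fun l =>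
        W.d_pos hp (h l l.2))
  rw [Complex.zero_le_real]
  have := W.ρda_nonneg
  positivity

/-- A nonzero block needs a serving AP and at least one antenna: for N = 0 all `D` matrices are
empty and the set `QSet` is empty. -/
lemma mem_QSet_self {k : Fin K} (hM : (W.M k).Nonempty) (hN : 0 < N) : k ∈ W.QSet k := by
  classical
  obtain ⟨l, hl⟩ := hM
  simp only [QSet, Finset.mem_filter, Finset.mem_univ, true_and]
  intro h
  have h' := congrFun (congrFun h (⟨0, hN⟩, l)) (⟨0, hN⟩, l)
  rw [D, ← blockDiagonal_mul, blockDiagonal_apply_eq] at h'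
  simp [hl] at h'

end ClosedForms
end Network
end SCF

/-! ### Data-phase noise and the spectral efficiency. -/

namespace SCF
namespace Network

namespace IsModel

variable {K L N τ : ℕ} {W : Network K L N τ} {Ω : Type*} [MeasurableSpace Ω]
  {P : Measure Ω} {X : Sources K L N τ Ω} (hX : W.IsModel P X) [IsProbabilityMeasure P]

include hX

lemma sigRV_mem_dependsOn (i : Fin K) : hX.sigRV i ∈ dependsOn P X (dataSources K L τ) :=
  hX.coord_mem_dependsOn (s := .sig i) (mem_dataSources.2 trivial) _

lemma dacRV_mem_dependsOn (i : Fin K) : hX.dacRV i ∈ dependsOn P X (dataSources K L τ) :=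
  hX.coord_mem_dependsOn (s := .dac i) (mem_dataSources.2 trivial) _

lemma recvRV_mem_dependsOn (l : Fin L) (a : Fin N) :
    hX.recvRV l a ∈ dependsOn P X (dataSources K L τ) :=
  hX.coord_mem_dependsOn (s := .recv l) (mem_dataSources.2 trivial) _

lemma adcRV_mem_dependsOn (l : Fin L) (a : Fin N) :
    hX.adcRV l a ∈ dependsOn P X (dataSources K L τ) :=
  hX.coord_mem_dependsOn (s := .adc l) (mem_dataSources.2 trivial) _

lemma expect_hRV_mul_star (i : Fin K) (l : Fin L) (a : Fin N) :
    expect P (hX.hRV i l a * star (hX.hRV i l a)) = (W.βLOS i l : ℂ) + W.R i l a a := by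
  have hg := hX.gaussian_joint
  have h0 := hX.integral_joint
  rw [hRV, star_add, star_constRV, add_mul, mul_add, mul_add, map_add, map_add, map_add,
    mul_comm (hX.chanRV i l a) (constRV P _), expect_const_mul, expect_const_mul,
    expect_const_mul, expect_const, expect_linearSpan hg h0 (hX.chanRV_mem_linearSpan i l a),
    expect_linearSpan hg h0 (star_mem_linearSpan (hX.chanRV_mem_linearSpan i l a)),
    expect_chanRV_mul_star, W.hbar_mul_conj]
  simp

lemma expect_star_hhatRV_mul (k : Fin K) (l : Fin L) (a : Fin N) :
    expect P (star (hX.hhatRV k l a) * hX.hhatRV k l a) = W.estPow k l a := by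
  have hg := hX.gaussian_joint
  have h0 := hX.integral_joint
  rw [hhatRV, star_add, star_constRV, add_mul, mul_add, mul_add, map_add, map_add, map_add,
    mul_comm (star (hX.estRV k l a)) (constRV P _), expect_const_mul, expect_const_mul,
    expect_const_mul, expect_const, expect_linearSpan hg h0 (hX.estRV_mem_linearSpan k l a),
    expect_linearSpan hg h0 (star_mem_linearSpan (hX.estRV_mem_linearSpan k l a)),
    mul_comm (star (hX.estRV k l a)), expect_estRV_mul_star_estRV, estPow]
  simp

/-- Power of an entry of the input of the ADCs. -/
lemma integral_adcIn_mul_conj (l : Fin L) (a : Fin N) :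
    ∫ ω, W.adcIn X l ω a * conj (W.adcIn X l ω a) ∂P =
      ∑ i, (W.p i : ℂ) * ((W.βLOS i l : ℂ) + W.R i l a a) + (W.σsq : ℂ) := by
  -- The index `none` carries the receiver noise with coefficient 1; `some i` carries the distorted
  -- symbol of UE i, with its channel as coefficient.
  let t : Option (Fin K) → momentAlgebra P := fun m => m.elim 1 fun i => hX.hRV i l a
  let y : Option (Fin K) → momentAlgebra P := fun m => m.elim (hX.recvRV l a) fun i =>
    constRV P (Real.sqrt (1 - W.ρda) : ℂ) * hX.sigRV i + hX.dacRV i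
  let v : Option (Fin K) → ℂ := fun m => m.elim (W.σsq : ℂ) fun i => (W.p i : ℂ)
  have heval : ∀ ω, evalRV P ω (∑ m, t m * y m) = W.adcIn X l ω a := fun ω => by
    rw [map_sum]
    simp only [map_mul, Fintype.sum_option, adcIn, Pi.add_apply, Finset.sum_apply,
      Pi.smul_apply, smul_eq_mul]
    rw [add_comm]
    refine congrArg₂ _ (Finset.sum_congr rfl fun i _ => ?_) ?_
    · simp only [t, y, Option.elim, map_add, map_mul, evalRV_constRV, evalRV_hRV]
      rw [mul_comm]
      rfl
    · simp only [t, y, Option.elim, map_one, one_mul]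
      rfl
  have hint : ∫ ω, W.adcIn X l ω a * conj (W.adcIn X l ω a) ∂P =
      expect P ((∑ m, t m * y m) * star (∑ m, t m * y m)) := by
    simp only [expect_eq_integral, map_mul, evalRV_star, heval]
  have ht : ∀ m, t m ∈ dependsOn P X (pilotSources K L τ) := by
    rintro (_ | i)
    · exact one_mem _
    · exact hX.hRV_mem_dependsOn i l a
  have hy : ∀ m, y m ∈ dependsOn P X (dataSources K L τ) := by
    rintro (_ | i)
    · exact hX.recvRV_mem_dependsOn l a
    · exact add_mem (mul_mem (const_mem_dependsOn _ _) (hX.sigRV_mem_dependsOn i))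
        (hX.dacRV_mem_dependsOn i)
  have z1 : ∀ i, expect P (hX.recvRV l a * star (hX.sigRV i)) = 0 := fun i =>
    hX.expect_coord_mul_star_coord_of_ne (by simp) _ _
  have z2 : ∀ i, expect P (hX.recvRV l a * star (hX.dacRV i)) = 0 := fun i =>
    hX.expect_coord_mul_star_coord_of_ne (by simp) _ _
  have z3 : ∀ i, expect P (hX.sigRV i * star (hX.recvRV l a)) = 0 := fun i =>
    hX.expect_coord_mul_star_coord_of_ne (by simp) _ _
  have z4 : ∀ i, expect P (hX.dacRV i * star (hX.recvRV l a)) = 0 := fun i =>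
    hX.expect_coord_mul_star_coord_of_ne (by simp) _ _
  have z5 : ∀ i j, expect P (hX.sigRV i * star (hX.dacRV j)) = 0 := fun i j =>
    hX.expect_coord_mul_star_coord_of_ne (by simp) _ _
  have z6 : ∀ i j, expect P (hX.dacRV i * star (hX.sigRV j)) = 0 := fun i j =>
    hX.expect_coord_mul_star_coord_of_ne (by simp) _ _
  have hcr : ∀ (u w : momentAlgebra P) (c : ℝ), expect P (u * star (constRV P (c : ℂ) * w)) =
      (c : ℂ) * expect P (u * star w) := fun u w c => by
    rw [star_mul, star_constRV, Complex.conj_ofReal, ← expect_const_mul]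
    congr 1
    ring
  have hv : ∀ m n, expect P (y m * star (y n)) = if m = n then v m else 0 := by
    rintro (_ | i) (_ | j)
    · exact (hX.expect_recvRV_mul_star l l a a).trans (by simp [v])
    · simp only [y, Option.elim, star_add, mul_add, map_add, hcr, z1, z2]
      simp
    · simp only [y, Option.elim, add_mul, map_add, mul_assoc, expect_const_mul, z3, z4]
      simp
    · simp only [y, v, Option.elim, star_add, mul_add, add_mul, map_add, hcr, mul_assoc,
        expect_const_mul, z5, z6, expect_sigRV_mul_star, expect_dacRV_mul_star, Option.some_inj]
      -- The DAC preserves the power: (1-ρ_da)p + ρ_da p = p.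
      have hs : (Real.sqrt (1 - W.ρda) : ℂ) * (Real.sqrt (1 - W.ρda) : ℂ) = 1 - W.ρda := by
        rw [← Complex.ofReal_mul, Real.mul_self_sqrt W.one_sub_ρda_pos.le]
        simp
      split_ifs
      · push_cast
        linear_combination (W.p i : ℂ) * hs
      · simp
  rw [hint, expect_sum_mul_star_sum hX.indep (fun s => (hX.gaussian s).aemeasurable)
    disjoint_pilotSources_dataSources ht ht hy hv, Fintype.sum_option, add_comm]
  simp [t, v, expect_hRV_mul_star]

lemma Cad_apply (l : Fin L) (a b : Fin N) :
    W.Cad P X l a b = if a = b then W.adcVar l a else 0 := by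
  simp only [Cad, Matrix.smul_apply, diagonal_apply, hX.integral_adcIn_mul_conj, adcVar,
    smul_eq_mul, mul_ite, mul_zero]

lemma expOuter_g (k i : Fin K) : expOuter P (W.g X (W.hhat X) k i) = W.gOuter k i := by
  have hm : ∀ l : W.M k, expect P (hX.gRV k i l) = W.gMean k i l := fun l => by
    rw [expect_gRV, gMean]
    split_ifs <;> rfl
  ext l l'
  have h := hX.expect_gRV_mul_star_gRV k i l l'
  rw [hm, hm, expect_eq_integral] at h
  simp only [map_mul, evalRV_star, evalRV_gRV] at h
  simp only [expOuter, Matrix.of_apply, h, gOuter, Matrix.add_apply, vecMulVec_apply,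
    diagonal_apply, Pi.star_apply, RCLike.star_def, Subtype.coe_inj]

lemma expVec_g (k : Fin K) : expVec P (W.g X (W.hhat X) k k) = W.gMean k k := by
  ext l
  have h := hX.expect_gRV k k l
  rw [if_pos (W.mem_PSet_self k), expect_eq_integral] at h
  simp only [evalRV_gRV] at h
  rw [gMean_self]
  exact h

lemma expect_gRV_mul_star_eq (k i : Fin K) (l l' : W.M k) :
    expect P (hX.gRV k i l * star (hX.gRV k i l')) = W.gOuter k i l l' := by
  rw [← hX.expOuter_g, expect_eq_integral]
  simp only [map_mul, evalRV_star, evalRV_gRV]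
  rfl

/-- The effective noise depends on the channels, hence on the estimates, but f is linear in the
data-phase noises. The coefficient of n_da,i is (1-ρ_ad)g_ki, and ρ_da p = ρ_da p̈/(1-ρ_da) gives
the first sum; the other noises give d. -/
lemma expOuter_f (k : Fin K) : expOuter P (W.f X (W.hhat X) k) =
    (((1 - W.ρad) ^ 2 * W.ρda / (1 - W.ρda) : ℝ) : ℂ) •
        ∑ i, (W.pdd i : ℂ) • W.gOuter k i + diagonal fun l : W.M k => W.d k l := by
  -- The three summands index DAC noise per UE, then receiver and ADC noise per AP and antenna. The
  -- test `l = m.1` keeps the noise of the own AP, so only DAC noise correlates different APs.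
  let t : Fin L → Fin K ⊕ (Fin L × Fin N) ⊕ (Fin L × Fin N) → momentAlgebra P := fun l =>
    Sum.elim (fun i => constRV P ((1 - W.ρad : ℝ) : ℂ) * hX.gRV k i l)
      (Sum.elim
        (fun m => if l = m.1 then
          constRV P ((1 - W.ρad : ℝ) : ℂ) * star (hX.hhatRV k l m.2) else 0)
        (fun m => if l = m.1 then star (hX.hhatRV k l m.2) else 0))
  let y : Fin K ⊕ (Fin L × Fin N) ⊕ (Fin L × Fin N) → momentAlgebra P :=
    Sum.elim hX.dacRV (Sum.elim (fun m => hX.recvRV m.1 m.2) (fun m => hX.adcRV m.1 m.2))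
  let v : Fin K ⊕ (Fin L × Fin N) ⊕ (Fin L × Fin N) → ℂ :=
    Sum.elim (fun i => ((W.ρda * W.p i : ℝ) : ℂ)) (Sum.elim (fun _ => (W.σsq : ℂ))
      (fun m => W.adcVar m.1 m.2))
  have heval : ∀ (l : W.M k) ω, evalRV P ω (∑ m, t l m * y m) =
      W.f X (W.hhat X) k ω l := fun l ω => by
    have hn : ∀ a, W.nEff X l ω a = ((1 - W.ρad : ℝ) : ℂ) *
        ∑ i, evalRV P ω (hX.dacRV i) * evalRV P ω (hX.hRV i l a)
          + ((1 - W.ρad : ℝ) : ℂ) * evalRV P ω (hX.recvRV l a) + evalRV P ω (hX.adcRV l a) :=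
      fun a => by
        simp only [nEff, Pi.add_apply, Pi.smul_apply, Finset.sum_apply, smul_eq_mul]
        rfl
    rw [map_sum]
    simp only [map_mul, Fintype.sum_sum_type, Fintype.sum_prod_type, t, y, Sum.elim_inl,
      Sum.elim_inr, f, dotProduct, hn, Pi.star_apply, RCLike.star_def, mul_add,
      Finset.sum_add_distrib, apply_ite (evalRV P ω), map_zero, ite_mul, zero_mul,
      evalRV_constRV, evalRV_star, ← hX.evalRV_hhatRV, gRV,
      map_sum]
    have hsum : ∀ F : Fin L → Fin N → ℂ,
        ∑ l' : Fin L, ∑ a, (if (l : Fin L) = l' then F l' a else 0) = ∑ a, F l a := fun F => by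
      rw [Finset.sum_comm]
      simp
    rw [hsum (fun l' a => ((1 - W.ρad : ℝ) : ℂ) * conj (evalRV P ω (hX.hhatRV k l a)) *
        evalRV P ω (hX.recvRV l' a)),
      hsum (fun l' a => conj (evalRV P ω (hX.hhatRV k l a)) * evalRV P ω (hX.adcRV l' a)),
      ← add_assoc]
    congr 2
    · simp only [Finset.mul_sum, Finset.sum_mul]
      rw [Finset.sum_comm]
      exact Finset.sum_congr rfl fun a _ => Finset.sum_congr rfl fun i _ => by ring
    · exact Finset.sum_congr rfl fun a _ => by ring
  have ht : ∀ l m, t l m ∈ dependsOn P X (pilotSources K L τ) := by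
    rintro l (i | ⟨l', a⟩ | ⟨l', a⟩)
    · exact mul_mem (const_mem_dependsOn _ _) (hX.gRV_mem_dependsOn k i l)
    · simp only [t, Sum.elim_inl, Sum.elim_inr]
      split_ifs
      · exact mul_mem (const_mem_dependsOn _ _) (star_mem (hX.hhatRV_mem_dependsOn k l a))
      · exact zero_mem _
    · simp only [t, Sum.elim_inr]
      split_ifs
      · exact star_mem (hX.hhatRV_mem_dependsOn k l a)
      · exact zero_mem _
  have hy : ∀ m, y m ∈ dependsOn P X (dataSources K L τ) := by
    rintro (i | m | m)
    · exact hX.dacRV_mem_dependsOn i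
    · exact hX.recvRV_mem_dependsOn _ _
    · exact hX.adcRV_mem_dependsOn _ _
  have hv : ∀ m n, expect P (y m * star (y n)) = if m = n then v m else 0 := by
    rintro (i | ⟨l, a⟩ | ⟨l, a⟩) (j | ⟨l', b⟩ | ⟨l', b⟩)
    · simpa [y, v] using hX.expect_dacRV_mul_star i j
    · exact hX.expect_coord_mul_star_coord_of_ne (by simp) _ _
    · exact hX.expect_coord_mul_star_coord_of_ne (by simp) _ _
    · exact hX.expect_coord_mul_star_coord_of_ne (by simp) _ _
    · simpa [y, v, -star_mul, -expect_star] using hX.expect_recvRV_mul_star l l' a b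
    · exact hX.expect_coord_mul_star_coord_of_ne (by simp) _ _
    · exact hX.expect_coord_mul_star_coord_of_ne (by simp) _ _
    · exact hX.expect_coord_mul_star_coord_of_ne (by simp) _ _
    · have := hX.expect_adcRV_mul_star l l' a b
      rw [hX.Cad_apply, ← ite_and] at this
      simpa [y, v] using this
  ext l l'
  have h := expect_sum_mul_star_sum hX.indep (fun s => (hX.gaussian s).aemeasurable)
    disjoint_pilotSources_dataSources (ht l) (ht l') hy hv
  rw [expect_eq_integral] at h
  simp only [map_mul (evalRV P _), evalRV_star, heval] at h
  have hgg : ∀ i, expect P (constRV P ((1 - W.ρad : ℝ) : ℂ) * hX.gRV k i l *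
      star (constRV P ((1 - W.ρad : ℝ) : ℂ) * hX.gRV k i l')) =
      (((1 - W.ρad) ^ 2 : ℝ) : ℂ) * W.gOuter k i l l' := fun i => by
    rw [← hX.expect_gRV_mul_star_eq, ← expect_const_mul, star_mul, star_constRV,
      Complex.conj_ofReal]
    congr 1
    simp only [constRV, Complex.ofReal_pow, map_pow]
    ring
  have hee : ∀ a, expect P (constRV P ((1 - W.ρad : ℝ) : ℂ) * star (hX.hhatRV k l a) *
      star (constRV P ((1 - W.ρad : ℝ) : ℂ) * star (hX.hhatRV k l a))) =
      (((1 - W.ρad) ^ 2 : ℝ) : ℂ) * W.estPow k l a := fun a => by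
    rw [← hX.expect_star_hhatRV_mul, ← expect_const_mul, star_mul, star_constRV,
      Complex.conj_ofReal, star_star]
    congr 1
    simp only [constRV, Complex.ofReal_pow, map_pow]
    ring
  have h1 : (1 - (W.ρda : ℂ)) ≠ 0 := by exact_mod_cast W.one_sub_ρda_pos.ne'
  rw [expOuter, Matrix.of_apply, h, Fintype.sum_sum_type, Fintype.sum_sum_type]
  simp only [Matrix.add_apply, Matrix.smul_apply, Matrix.sum_apply, smul_eq_mul, diagonal_apply]
  congr 1
  · rw [Finset.mul_sum]
    refine Finset.sum_congr rfl fun i _ => ?_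
    simp only [t, v, Sum.elim_inl, hgg, pdd]
    push_cast
    field_simp
  · simp only [Fintype.sum_prod_type, t, v, Sum.elim_inl, Sum.elim_inr]
    by_cases hl : l = l'
    · subst hl
      rw [if_pos rfl, d_eq_sum, Finset.sum_eq_single (l : Fin L)
        (fun b _ hb => by simp [hb.symm]) (fun hb => absurd (Finset.mem_univ _) hb),
        Finset.sum_eq_single (l : Fin L)
        (fun b _ hb => by simp [hb.symm]) (fun hb => absurd (Finset.mem_univ _) hb),
        ← Finset.sum_add_distrib]
      refine Finset.sum_congr rfl fun a _ => ?_
      simp only [if_true, hee, star_star, hX.expect_star_hhatRV_mul]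
      push_cast
      ring
    · have hl' : (l : Fin L) ≠ l' := fun h => hl (Subtype.ext h)
      have hz : ∀ (y z : momentAlgebra P) (b : Fin L),
          (if (l : Fin L) = b then y else 0) * star (if (l' : Fin L) = b then z else 0) = 0 :=
        fun y z b => by
          by_cases hb : (l : Fin L) = b
          · have hb' : (l' : Fin L) ≠ b := fun h => hl' (hb.trans h.symm)
            rw [if_neg hb', star_zero, mul_zero]
          · rw [if_neg hb, zero_mul]
      simp [hl, hz, -star_mul]

/-- Mean power of a linear combination of the effective channels. -/
lemma integral_norm_sq_g (k i : Fin K) (a : W.M k → ℂ) :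
    ((∫ ω, ‖star a ⬝ᵥ W.g X (W.hhat X) k i ω‖ ^ 2 ∂P : ℝ) : ℂ) =
      star a ⬝ᵥ (W.gOuter k i *ᵥ a) := by
  let y : momentAlgebra P := ∑ l : W.M k, constRV P (conj (a l)) * hX.gRV k i l
  have hy : ∀ ω, evalRV P ω y = star a ⬝ᵥ W.g X (W.hhat X) k i ω := fun ω => by
    simp only [y, map_sum, map_mul, evalRV_constRV, evalRV_gRV]
    rfl
  have h : ((∫ ω, ‖star a ⬝ᵥ W.g X (W.hhat X) k i ω‖ ^ 2 ∂P : ℝ) : ℂ) =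
      expect P (y * star y) := by
    rw [← integral_complex_ofReal, expect_eq_integral]
    refine integral_congr_ae (.of_forall fun ω => ?_)
    simp only [map_mul, evalRV_star, hy, Complex.mul_conj']
    push_cast
    rfl
  rw [h, expect_sum_const_mul_mul]
  simp only [y, expect_mul_star_sum_const_mul, hX.expect_gRV_mul_star_eq, Complex.conj_conj,
    dotProduct, mulVec, Pi.star_apply, RCLike.star_def]
  exact Finset.sum_congr rfl fun l _ => congrArg _ (Finset.sum_congr rfl fun l' _ =>
    mul_comm _ _)

lemma aPMR_eq (k : Fin K) : W.aPMR P X k = (W.CP k)⁻¹ *ᵥ W.gMean k k := by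
  rw [CP, CMat_eq, aPMR]
  simp only [hX.expVec_g, hX.expOuter_g]
  congr 2
  abel

/-- This holds for every weighting vector: the data term and the DAC noise carry the same matrices,
with weights 1 and ρ_da/(1-ρ_da) adding up to 1/(1-ρ_da). -/
lemma ulSE_eq (τc : ℕ) (k : Fin K) (a : W.M k → ℂ) :
    W.ulSE P X τc (W.hhat X) k a =
      (1 - (τ : ℝ) / (τc : ℝ)) * Real.logb 2 (1 +
        (1 - W.ρad) ^ 2 * W.pdd k * ‖star a ⬝ᵥ W.gMean k k‖ ^ 2 /
          (star a ⬝ᵥ (W.C k *ᵥ a)).re) := by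
  have hden : star a ⬝ᵥ (W.C k *ᵥ a) =
      (((1 - W.ρad) ^ 2 * ∑ i, W.pdd i * ∫ ω, ‖star a ⬝ᵥ W.g X (W.hhat X) k i ω‖ ^ 2 ∂P
        - (1 - W.ρad) ^ 2 * W.pdd k * ‖star a ⬝ᵥ W.gMean k k‖ ^ 2 : ℝ) : ℂ)
      + star a ⬝ᵥ (expOuter P (W.f X (W.hhat X) k) *ᵥ a) := by
    have hv : star a ⬝ᵥ (vecMulVec (W.gMean k k) (star (W.gMean k k)) *ᵥ a) =
        ((‖star a ⬝ᵥ W.gMean k k‖ ^ 2 : ℝ) : ℂ) := by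
      rw [vecMulVec_mulVec, dotProduct_smul, Complex.ofReal_pow, ← Complex.mul_conj',
        show conj (star a ⬝ᵥ W.gMean k k) = star (star a ⬝ᵥ W.gMean k k) from rfl,
        star_dotProduct]
      rfl
    have h1 : (1 - (W.ρda : ℂ)) ≠ 0 := by exact_mod_cast W.one_sub_ρda_pos.ne'
    rw [C, CMat_eq, hX.expOuter_f]
    simp only [add_mulVec, sub_mulVec, smul_mulVec, dotProduct_add, dotProduct_sub,
      dotProduct_smul, hv, smul_eq_mul, sum_mulVec, dotProduct_sum, ← hX.integral_norm_sq_g]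
    push_cast
    field_simp
    ring
  rw [ulSE, hX.expVec_g, hden, Complex.add_re, Complex.ofReal_re]

end IsModel

end Network
end SCF

end

/-! ### The corollary. -/

theorem mainTheorem4 {K L N τ τc : ℕ} (hτ : τ ≤ τc) (W : SCF.Network K L N τ)
    {Ω : Type*} [MeasurableSpace Ω] (P : MeasureTheory.Measure Ω)
    [MeasureTheory.IsProbabilityMeasure P] (X : SCF.Sources K L N τ Ω)
    (hX : W.IsModel P X) (k : Fin K) :
    -- the P-LSFD vector in closed form
    W.aPMR P X k = (W.CP k)⁻¹ *ᵥ (W.lamV k k + W.bV k k) ∧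
    -- the spectral efficiency with MRC at the APs and the P-LSFD vector at the CPU
    W.ulSE P X τc (W.hhat X) k (W.aPMR P X k) =
      (1 - (τ : ℝ) / (τc : ℝ)) * Real.logb 2 (1 +
        (1 - W.ρad) ^ 2 * W.pdd k * ‖star (W.aPMR P X k) ⬝ᵥ (W.lamV k k + W.bV k k)‖ ^ 2 /
          (star (W.aPMR P X k) ⬝ᵥ (W.C k *ᵥ W.aPMR P X k)).re) ∧
    -- the inverse and the quotient are meaningful
    (0 < W.p k → (W.M k).Nonempty → (∀ l ∈ W.M k, W.hbar k l ≠ 0 ∨ W.R k l ≠ 0) →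
      IsUnit (W.CP k).det ∧
        0 < star (W.aPMR P X k) ⬝ᵥ (W.C k *ᵥ W.aPMR P X k)) := by
  rw [← W.gMean_self]
  refine ⟨hX.aPMR_eq k, hX.ulSE_eq τc k _, fun hp hM h => ?_⟩
  obtain ⟨l, hl⟩ := hM
  -- Without antennas h̄ and R would both be zero, so the nondegeneracy hypothesis at one serving AP
  -- yields N > 0.
  have hN : 0 < N := by
    rcases h l hl with h' | h'
    · obtain ⟨a, -⟩ := Function.ne_iff.1 h'
      exact Fin.pos a
    · by_contra h0
      obtain rfl : N = 0 := by omega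
      exact h' (Subsingleton.elim _ _)
  have hCP : (W.CP k).PosDef := W.CMat_posDef hp h (W.mem_QSet_self ⟨l, hl⟩ hN)
  have hC : (W.C k).PosDef := W.CMat_posDef hp h (Finset.mem_univ k)
  have hunit : IsUnit (W.CP k).det := (isUnit_iff_isUnit_det _).1 hCP.isUnit
  refine ⟨hunit, hC.dotProduct_mulVec_pos fun h0 => ?_⟩
  -- If the weighting vector vanished, applying C_k^P to it would give λ + b = 0, against the
  -- positivity of its entries.
  have hm : W.gMean k k = 0 := by
    have h1 := congrArg (W.CP k *ᵥ ·) (hX.aPMR_eq k)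
    simp only [h0, mulVec_zero, mulVec_mulVec, mul_nonsing_inv _ hunit, one_mulVec] at h1
    exact h1.symm
  rw [W.gMean_self] at hm
  exact (W.lam_add_b_pos hp (h l hl)).ne' (congrFun hm ⟨l, hl⟩)
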